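/- Let $X\subseteq\mathbb R^n$ and $U\subseteq\mathbb R^m$ be closed and convex, and let $\mathbb R^n$ and $\mathbb R^m$ be ordered by closed convex pointed cones with nonempty interiors. Assume that every bounded subset of $X$ is contained in an order interval $\{s : a\le s\le b\}$ with $a,b\in X$. Let $f:X\times U\to\mathbb R^n$ and $h:X\to U$ be continuous, and suppose that for every initial state in $X$ and every measurable, locally bounded input $u:[0,\infty)\to U$ the equation $\dot x=f(x,u)$ has a unique maximal solution with values in $X$. Suppose that the system $\dot x=f(x,u)$, $y=h(x)$ is input/output anti-monotone, that is: * (monotonicity) if $\dot x=f(x,u)$, $\dot x'=f(x',u')$, $x(0)\le x'(0)$ and $u(t)\le u'(t)$ for all $t\ge 0$, then $x(t)\le x'(t)$ for all $t\ge 0$ in the common domain of definition; * (anti-monotone output) $x\le x'$ in $X$ implies $h(x)\ge h(x')$. Suppose further that every solution in $X\times X$ of the extended closed loop $$\dot x=f(x,h(z)),\qquad \dot z=f(z,h(x))$$ is bounded, and that this closed loop has a unique steady state, i.e. there is exactly one $(x,z)\in X\times X$ with $f(x,h(z))=0$ and $f(z,h(x))=0$. Then there is a state $\bar x\in X$ such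 that every maximal solution in $X$ of the negative-feedback system $\dot x=f(x,h(x))$ is defined for all $t\ge 0$ and converges to $\bar x$ as $t\to\infty$. -/

import Mathlib

open MeasureTheory Set Filter Topology

/-- The order induced by a cone `K`: `x ≤ y` if and only if `y - x ∈ K`. -/
def coneLE {E : Type*} [NormedAddCommGroup E] [NormedSpace ℝ E] (K : ProperCone ℝ E)
    (x y : E) : Prop :=
  y - x ∈ K

/-- Admissible inputs: measurable, locally bounded functions of time `t ≥ 0` with values in `U`. -/
structure IsInput {F : Type*} [NormedAddCommGroup F] [MeasurableSpace F]
    (U : Set F) (u : ℝ → F) : Prop where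
  measurable : Measurable u
  mem : ∀ t : ℝ, 0 ≤ t → u t ∈ U
  locallyBounded : ∀ T : ℝ, Bornology.IsBounded (u '' Icc 0 T)

/-- `x` is an `X`-valued solution on `[0, τ)`, where `0 < τ ≤ ∞`, of `x' = f(x, u)` with the
input `u`, in the sense of Carathéodory (for continuous `f` and `u` this is the classical sense). -/
structure IsSolution {E F : Type*} [NormedAddCommGroup E] [NormedSpace ℝ E]
    (f : E → F → E) (X : Set E) (u : ℝ → F) (τ : EReal) (x : ℝ → E) : Prop where
  pos : 0 < τ
  mem : ∀ t : ℝ, 0 ≤ t → (t : EReal) < τ → x t ∈ X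
  integrable : ∀ t : ℝ, 0 ≤ t → (t : EReal) < τ →
    IntervalIntegrable (fun s => f (x s) (u s)) volume 0 t
  eq_integral : ∀ t : ℝ, 0 ≤ t → (t : EReal) < τ →
    x t = x 0 + ∫ s in (0 : ℝ)..t, f (x s) (u s)

/-- Existence and uniqueness of solutions in `X` of `x' = f(x, u)` for every initial state in `X`
and every admissible input. Local existence together with uniqueness on common intervals is
existence and uniqueness of maximal solutions. Solutions are `X`-valued, so that this contains
the invariance of `X`. -/
structure IsWellPosed {E F : Type*} [NormedAddCommGroup E] [NormedSpace ℝ E]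
    [NormedAddCommGroup F] [MeasurableSpace F]
    (f : E → F → E) (X : Set E) (U : Set F) : Prop where
  exists_solution : ∀ u : ℝ → F, IsInput U u → ∀ x₀ ∈ X,
    ∃ (τ : EReal) (x : ℝ → E), IsSolution f X u τ x ∧ x 0 = x₀
  unique : ∀ u : ℝ → F, IsInput U u → ∀ (τ : EReal) (x x' : ℝ → E),
    IsSolution f X u τ x → IsSolution f X u τ x' → x 0 = x' 0 →
    ∀ t : ℝ, 0 ≤ t → (t : EReal) < τ → x t = x' t

/-- The system with inputs `x' = f(x, u)` is monotone: ordered initial states and ordered inputs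
give ordered solutions on the common domain of definition. -/
def IsMonotoneSystem {E F : Type*} [NormedAddCommGroup E] [NormedSpace ℝ E]
    [NormedAddCommGroup F] [NormedSpace ℝ F] [MeasurableSpace F]
    (f : E → F → E) (X : Set E) (U : Set F) (K : ProperCone ℝ E) (L : ProperCone ℝ F) : Prop :=
  ∀ u u' : ℝ → F, IsInput U u → IsInput U u' → (∀ t : ℝ, 0 ≤ t → coneLE L (u t) (u' t)) →
    ∀ (τ τ' : EReal) (x x' : ℝ → E), IsSolution f X u τ x → IsSolution f X u' τ' x' →
      coneLE K (x 0) (x' 0) →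
      ∀ t : ℝ, 0 ≤ t → (t : EReal) < τ → (t : EReal) < τ' → coneLE K (x t) (x' t)

/-- The system `x' = f(x, u)`, `y = h(x)` is i/o anti-monotone: it is monotone as a system with
inputs, and the output map reverses the order. -/
structure IsIOAntiMonotone {E F : Type*} [NormedAddCommGroup E] [NormedSpace ℝ E]
    [NormedAddCommGroup F] [NormedSpace ℝ F] [MeasurableSpace F]
    (f : E → F → E) (h : E → F) (X : Set E) (U : Set F)
    (K : ProperCone ℝ E) (L : ProperCone ℝ F) : Prop where
  monotone : IsMonotoneSystem f X U K L
  antitone : ∀ x ∈ X, ∀ x' ∈ X, coneLE K x x' → coneLE L (h x') (h x)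

/-- `(x, z)` is a solution on `[0, τ)` of the extended closed loop
`x' = f(x, h(z))`, `z' = f(z, h(x))`. -/
def IsExtendedSolution {E F : Type*} [NormedAddCommGroup E] [NormedSpace ℝ E]
    (f : E → F → E) (h : E → F) (X : Set E) (τ : EReal) (x z : ℝ → E) : Prop :=
  IsSolution f X (fun t => h (z t)) τ x ∧ IsSolution f X (fun t => h (x t)) τ z

/-- `x` is a solution on `[0, τ)` of the feedback system `x' = f(x, h(x))`. -/
def IsFeedbackSolution {E F : Type*} [NormedAddCommGroup E] [NormedSpace ℝ E]
    (f : E → F → E) (h : E → F) (X : Set E) (τ : EReal) (x : ℝ → E) : Prop :=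
  IsSolution f X (fun t => h (x t)) τ x

/-- `x`, on `[0, τ)`, is a maximal solution of the feedback system `x' = f(x, h(x))`. -/
def IsMaximalFeedbackSolution {E F : Type*} [NormedAddCommGroup E] [NormedSpace ℝ E]
    (f : E → F → E) (h : E → F) (X : Set E) (τ : EReal) (x : ℝ → E) : Prop :=
  IsFeedbackSolution f h X τ x ∧
    ∀ (τ' : EReal) (x' : ℝ → E), IsFeedbackSolution f h X τ' x' → τ ≤ τ' →
      (∀ t : ℝ, 0 ≤ t → (t : EReal) < τ → x' t = x t) → τ' = τ

/-- `(x, z)` is a steady state in `X × X` of the extended closed loop. -/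
def IsExtendedSteadyState {E F : Type*} [NormedAddCommGroup E]
    (f : E → F → E) (h : E → F) (X : Set E) (p : E × E) : Prop :=
  p.1 ∈ X ∧ p.2 ∈ X ∧ f p.1 (h p.2) = 0 ∧ f p.2 (h p.1) = 0

/-! A feedback solution `x` gives the diagonal solution `(x, x)` of the extended loop, and
anti-monotonicity makes that loop monotone for the order `mixedLE` (first component up, second
down). Let `W₁` be the limit set of `(x, x)`. A solution started at a point of `X × X` below `W₁`
can be kept below `W₁`, and so can its limit set `W₂`; repeating this gives `W₃` below `W₂`. The
points of `X × X` lying above `W₃` and below `W₁` form a set `D` that is convex, compact (pointed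
closed cones are normal), nonempty (it contains `W₂`) and invariant, so `D` contains a steady state,
necessarily the unique one, `e`. The loop is symmetric under the swap, so `e` lies on the diagonal;
so does every `w ∈ W₁`. For diagonal points, `e` below `w` in the mixed order means both `e.1 ≤ w.1`
and `w.1 ≤ e.1`, so `w = e` because `K` is pointed. Thus `W₁ = {e}`, and the bounded solution
converges.

Only the open loop is known to have unique, monotone solutions. Invariance is therefore stated for
open-loop responses to curves in the set (`LoopInvariant`); `exists_isSolution_extendedField_local`
then produces closed-loop solutions inside the set as limits of delayed loops. The order sets are
invariant because limit sets are backward invariant (`IsBackwardInvariant.loopInvariant_lower`). The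
steady state in `D` comes from `LoopInvariant.exists_isExtendedSteadyState`, which rests on a
variational inequality and hence on Brouwer's theorem, proved here by the volume argument of Milnor
and Rogers. -/

/-! ### No-retraction theorem by the polynomial volume argument. -/

section Brouwer

/-- The determinant of `1 + t A` is a polynomial in `t` of degree at most the dimension. -/
theorem exists_polynomial_eval_eq_det_one_add_smul {E : Type*} [NormedAddCommGroup E]
    [NormedSpace ℝ E] [FiniteDimensional ℝ E] (A : E →L[ℝ] E) :
    ∃ P : Polynomial ℝ, P.natDegree ≤ Module.finrank ℝ E ∧
      ∀ t : ℝ, P.eval t = (ContinuousLinearMap.id ℝ E + t • A).det := by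
  classical
  set b := Module.finBasis ℝ E
  set M := LinearMap.toMatrix b b (A : E →ₗ[ℝ] E) with hM
  refine ⟨Matrix.det ((Polynomial.X : Polynomial ℝ) • M.map Polynomial.C +
    (1 : Matrix _ _ ℝ).map Polynomial.C), ?_, fun t => ?_⟩
  · simpa using Polynomial.natDegree_det_X_add_C_le M 1
  · have h1 : (ContinuousLinearMap.id ℝ E + t • A).det =
        LinearMap.det ((LinearMap.id : E →ₗ[ℝ] E) + t • (A : E →ₗ[ℝ] E)) := rfl
    rw [h1, ← LinearMap.det_toMatrix b, map_add, map_smul, LinearMap.toMatrix_id, ← hM,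
      ← Polynomial.coe_evalRingHom, RingHom.map_det]
    congr 1
    ext i j
    simp [Matrix.one_apply, add_comm]
    split_ifs <;> simp [mul_comm]

/-- For `t ∈ [0, 1]` the map `1 + tA` is injective because `‖tA‖ < 1`, so its determinant does not
vanish on the segment and keeps the sign it has at `t = 0`. -/
theorem det_one_add_pos {E : Type*} [NormedAddCommGroup E] [NormedSpace ℝ E]
    [FiniteDimensional ℝ E] (A : E →L[ℝ] E) (hA : ‖A‖ < 1) :
    0 < (ContinuousLinearMap.id ℝ E + A).det := by
  obtain ⟨P, -, hP⟩ := exists_polynomial_eval_eq_det_one_add_smul A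
  have hne : ∀ t ∈ Icc (0 : ℝ) 1, P.eval t ≠ 0 := by
    intro t ht h0
    rw [hP] at h0
    have hinj : Function.Injective (ContinuousLinearMap.id ℝ E + t • A) := by
      rw [injective_iff_map_eq_zero]
      intro v hv
      have h2 : v = -(t • A v) := by
        rw [eq_neg_iff_add_eq_zero]; simpa using hv
      have h3 : ‖v‖ ≤ ‖A‖ * ‖v‖ := by
        calc ‖v‖ = ‖t • A v‖ := by conv_lhs => rw [h2, norm_neg]
          _ = t * ‖A v‖ := by rw [norm_smul, Real.norm_of_nonneg ht.1]
          _ ≤ 1 * ‖A v‖ := by gcongr; exact ht.2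
          _ ≤ ‖A‖ * ‖v‖ := by rw [one_mul]; exact A.le_opNorm v
      by_contra hv0
      have : 0 < ‖v‖ := norm_pos_iff.2 hv0
      nlinarith
    have h4 : LinearMap.ker (((ContinuousLinearMap.id ℝ E + t • A) : E →L[ℝ] E) : E →ₗ[ℝ] E) = ⊥ :=
      LinearMap.ker_eq_bot.2 hinj
    exact (LinearMap.bot_lt_ker_of_det_eq_zero h0).ne' h4
  have h0 : P.eval 0 = 1 := by
    rw [hP, zero_smul, add_zero]; exact LinearMap.det_id
  have h1 : P.eval 1 = (ContinuousLinearMap.id ℝ E + A).det := by rw [hP, one_smul]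
  rw [← h1]
  by_contra! hneg
  obtain ⟨t, ht, h⟩ := intermediate_value_Icc' (zero_le_one' ℝ)
    (P.continuous.continuousOn (s := Icc 0 1)) ⟨hneg, by rw [h0]; exact zero_le_one⟩
  exact hne t ht h

/-- Lagrange interpolation at `finrank + 1` nodes recovers the value at `1` of a polynomial in `t`.
The weights do not depend on `A`, so the identity can be integrated over `x` with `A` the derivative
at `x`. -/
theorem det_one_add_eq_sum {E : Type*} [NormedAddCommGroup E] [NormedSpace ℝ E]
    [FiniteDimensional ℝ E] (v : ℕ → ℝ) (hv : Function.Injective v) :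
    ∃ c : ℕ → ℝ, ∑ i ∈ Finset.range (Module.finrank ℝ E + 1), c i = 1 ∧ ∀ A : E →L[ℝ] E,
      (ContinuousLinearMap.id ℝ E + A).det =
        ∑ i ∈ Finset.range (Module.finrank ℝ E + 1),
          c i * (ContinuousLinearMap.id ℝ E + v i • A).det := by
  set s := Finset.range (Module.finrank ℝ E + 1)
  refine ⟨fun i => (Lagrange.basis s v i).eval 1, ?_, fun A => ?_⟩
  · rw [← Polynomial.eval_finsetSum, Lagrange.sum_basis hv.injOn ⟨0, by simp [s]⟩]
    simp
  · obtain ⟨P, hdeg, hP⟩ := exists_polynomial_eval_eq_det_one_add_smul A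
    have hlt : P.degree < s.card := by
      refine lt_of_le_of_lt Polynomial.degree_le_natDegree ?_
      simp only [s, Finset.card_range]
      exact_mod_cast Nat.lt_succ_of_le hdeg
    have h1 := congrArg (Polynomial.eval 1) (Lagrange.eq_interpolate hv.injOn hlt)
    rw [hP, one_smul, Lagrange.interpolate_apply, Polynomial.eval_finsetSum] at h1
    rw [h1]
    refine Finset.sum_congr rfl fun i _ => ?_
    rw [Polynomial.eval_mul, Polynomial.eval_C, hP, mul_comm]

variable {E : Type*} [NormedAddCommGroup E] [InnerProductSpace ℝ E] [FiniteDimensional ℝ E]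

/-- A small `C¹` perturbation of the identity that fixes the unit sphere maps the open unit ball
onto itself. -/
theorem image_ball_eq_of_small_perturbation {g : E → E} {O : Set E} (hO : IsOpen O)
    (hball : Metric.closedBall (0 : E) 1 ⊆ O) (hg : ContDiffOn ℝ 1 g O)
    (hsphere : ∀ x, ‖x‖ = 1 → g x = 0) (hmaps : ∀ x, ‖x‖ < 1 → ‖x + g x‖ < 1)
    (hsmall : ∀ x ∈ Metric.ball (0 : E) 1, ‖fderiv ℝ g x‖ < 1) :
    (fun x => x + g x) '' Metric.ball 0 1 = Metric.ball 0 1 := by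
  set F : E → E := fun x => x + g x with hF
  have hcont : ContinuousOn F (Metric.closedBall 0 1) :=
    continuousOn_id.add (hg.continuousOn.mono hball)
  have hopen : IsOpen (F '' Metric.ball 0 1) := by
    rw [isOpen_iff_mem_nhds]
    rintro _ ⟨x, hx, rfl⟩
    have hgx : ContDiffAt ℝ 1 g x :=
      hg.contDiffAt (hO.mem_nhds (hball (Metric.ball_subset_closedBall hx)))
    have hstrict : HasStrictFDerivAt F (ContinuousLinearMap.id ℝ E + fderiv ℝ g x) x :=
      (hasStrictFDerivAt_id x).add (hgx.hasStrictFDerivAt one_ne_zero)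
    have hdet := det_one_add_pos _ (hsmall x hx)
    set e := ContinuousLinearMap.toContinuousLinearEquivOfDetNeZero _ hdet.ne' with he
    have hstrict' : HasStrictFDerivAt F (e : E →L[ℝ] E) x := by simpa [he] using hstrict
    rw [← hstrict'.map_nhds_eq_of_equiv]
    exact image_mem_map (Metric.isOpen_ball.mem_nhds hx)
  have hsub : F '' Metric.ball 0 1 ⊆ Metric.ball 0 1 := by
    rintro _ ⟨x, hx, rfl⟩
    rw [mem_ball_zero_iff] at hx ⊢
    exact hmaps x hx
  -- Connectedness of the ball: the image is open, and it is closed relative to the ball since a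
  -- limit point coming from the sphere is fixed and has norm one.
  refine Subset.antisymm hsub ?_
  have hcompact : IsCompact (F '' Metric.closedBall 0 1) :=
    (isCompact_closedBall 0 1).image_of_continuousOn hcont
  have hpre : IsPreconnected (Metric.ball (0 : E) 1) := (convex_ball 0 1).isPreconnected
  refine hpre.subset_of_closure_inter_subset hopen ?_ ?_
  · refine ⟨F 0, hsub ⟨0, by simp, rfl⟩, 0, by simp, rfl⟩
  · rintro y ⟨hy, hyb⟩
    have : y ∈ F '' Metric.closedBall 0 1 :=
      closure_minimal (image_mono Metric.ball_subset_closedBall) hcompact.isClosed hy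
    obtain ⟨x, hx, rfl⟩ := this
    rw [mem_closedBall_zero_iff] at hx
    rcases hx.lt_or_eq with h | h
    · exact ⟨x, by simpa using h, rfl⟩
    · exfalso
      simp [hF, hsphere x h, h] at hyb

/-- There is no `C¹` retraction of the closed unit ball onto the unit sphere. -/
theorem no_contDiff_retraction {r : E → E} {O : Set E} (hO : IsOpen O)
    (hball : Metric.closedBall (0 : E) 1 ⊆ O) (hr : ContDiffOn ℝ 1 r O)
    (hfix : ∀ x, ‖x‖ = 1 → r x = x) (hnorm : ∀ x, ‖x‖ ≤ 1 → ‖r x‖ = 1) : False := by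
  borelize E
  set μ : Measure E := Measure.addHaar
  set B := Metric.ball (0 : E) 1
  have hBO : B ⊆ O := Metric.ball_subset_closedBall.trans hball
  set g : E → E := fun x => r x - x with hg_def
  have hg : ContDiffOn ℝ 1 g O := hr.sub contDiffOn_id
  have hgd : ∀ x ∈ O, HasFDerivAt g (fderiv ℝ g x) x := fun x hx =>
    ((hg.contDiffAt (hO.mem_nhds hx)).differentiableAt one_ne_zero).hasFDerivAt
  have hfcont : ContinuousOn (fderiv ℝ g) O := hg.continuousOn_fderiv_of_isOpen hO le_rfl
  obtain ⟨C, hC⟩ := (isCompact_closedBall (0 : E) 1).exists_bound_of_continuousOn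
    (hfcont.mono hball)
  have hC0 : 0 ≤ C := (norm_nonneg _).trans (hC 0 (by simp))
  have hlip : ∀ x ∈ B, ∀ y ∈ B, ‖g y - g x‖ ≤ C * ‖y - x‖ := fun x hx y hy =>
    (convex_ball 0 1).norm_image_sub_le_of_norm_fderiv_le
      (fun z hz => (hgd z (hBO hz)).differentiableAt)
      (fun z hz => hC z (Metric.ball_subset_closedBall hz)) hx hy
  -- for small `t`, the map `x + t g(x)` is a bijection of the ball
  have key : ∀ t : ℝ, 0 < t → t * (C + 2) ≤ 1 →
      ∫ x in B, (ContinuousLinearMap.id ℝ E + t • fderiv ℝ g x).det ∂μ = μ.real B := by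
    intro t ht htC
    -- The factor `C + 2` yields both `t < 1`, for the convex combination below, and `t * C < 1`,
    -- for injectivity and positive determinants.
    have ht1 : t < 1 := by nlinarith
    have htC' : t * C < 1 := by nlinarith
    have hsm : ∀ x ∈ B, ‖t • fderiv ℝ g x‖ < 1 := by
      intro x hx
      rw [norm_smul, Real.norm_of_nonneg ht.le]
      refine lt_of_le_of_lt ?_ htC'
      gcongr
      exact hC x (Metric.ball_subset_closedBall hx)
    have himage : (fun x => x + t • g x) '' B = B := by
      refine image_ball_eq_of_small_perturbation hO hball (contDiffOn_const.smul hg) ?_ ?_ ?_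
      · intro x hx
        simp [hg_def, hfix x hx]
      · intro x hx
        have : x + t • g x = (1 - t) • x + t • r x := by simp only [hg_def]; module
        rw [this]
        calc ‖(1 - t) • x + t • r x‖ ≤ (1 - t) * ‖x‖ + t * ‖r x‖ := by
              refine (norm_add_le _ _).trans_eq ?_
              rw [norm_smul, norm_smul, Real.norm_of_nonneg ht.le,
                Real.norm_of_nonneg (sub_nonneg.2 ht1.le)]
          _ < 1 := by
              rw [hnorm x hx.le]
              nlinarith
      · intro x hx
        have := ((hgd x (hBO hx)).const_smul t).fderiv
        rw [show (fun x => t • g x) = t • g from rfl, this]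
        exact hsm x hx
    have hinj : InjOn (fun x => x + t • g x) B := by
      intro x hx y hy hxy
      have h1 : y - x = -(t • (g y - g x)) := by
        have : x + t • g x = y + t • g y := hxy
        rw [smul_sub, eq_neg_iff_add_eq_zero]
        rw [← sub_eq_zero] at this
        rw [← neg_eq_zero, ← this]
        abel
      have h2 : ‖y - x‖ ≤ t * C * ‖y - x‖ := by
        calc ‖y - x‖ = t * ‖g y - g x‖ := by
              conv_lhs => rw [h1]
              rw [norm_neg, norm_smul, Real.norm_of_nonneg ht.le]
          _ ≤ t * (C * ‖y - x‖) := by gcongr; exact hlip x hx y hy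
          _ = _ := by ring
      have h3 : ‖y - x‖ = 0 := by nlinarith [norm_nonneg (y - x)]
      exact (sub_eq_zero.1 (norm_eq_zero.1 h3)).symm
    have hcv := integral_image_eq_integral_abs_det_fderiv_smul μ Metric.isOpen_ball.measurableSet
      (f' := fun x => ContinuousLinearMap.id ℝ E + t • fderiv ℝ g x)
      (fun x hx => ((hasFDerivAt_id x).add
        ((hgd x (hBO hx)).const_smul t)).hasFDerivWithinAt) hinj (fun _ => (1 : ℝ))
    have himage' : (id + t • g) '' B = B := himage
    rw [himage'] at hcv
    simp only [smul_eq_mul, mul_one, integral_const, measureReal_restrict_apply_univ] at hcv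
    rw [hcv]
    refine setIntegral_congr_fun Metric.isOpen_ball.measurableSet fun x hx => ?_
    exact (abs_of_pos (det_one_add_pos _ (hsm x hx))).symm
  -- Since `‖r‖ = 1` on the ball, the derivative of `r` at `x` takes values orthogonal to `r x`, so
  -- it is not surjective.
  have hdet0 : ∀ x ∈ B, (ContinuousLinearMap.id ℝ E + fderiv ℝ g x).det = 0 := by
    intro x hx
    have hrd : HasFDerivAt r (ContinuousLinearMap.id ℝ E + fderiv ℝ g x) x := by
      have := (hasFDerivAt_id x).add (hgd x (hBO hx))
      refine this.congr_of_eventuallyEq (Eventually.of_forall fun y => ?_)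
      simp [hg_def]
    set R := ContinuousLinearMap.id ℝ E + fderiv ℝ g x
    have horth : ∀ v, inner ℝ (r x) (R v) = 0 := by
      intro v
      have h1 := hrd.inner ℝ hrd
      have h2 : HasFDerivAt (fun y => inner ℝ (r y) (r y)) (0 : E →L[ℝ] ℝ) x := by
        refine (hasFDerivAt_const (1 : ℝ) x).congr_of_eventuallyEq ?_
        filter_upwards [Metric.isOpen_ball.mem_nhds hx] with y hy
        rw [real_inner_self_eq_norm_sq, hnorm y (by simpa using (mem_ball_zero_iff.1 hy).le)]
        simp
      have h3 := congrArg (fun T : E →L[ℝ] ℝ => T v) (h1.unique h2)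
      simp [real_inner_comm] at h3
      exact h3
    by_contra hne
    set e := ContinuousLinearMap.toContinuousLinearEquivOfDetNeZero _ hne with he
    have h1 := horth (e.symm (r x))
    have h2 : R (e.symm (r x)) = r x := by
      exact e.apply_symm_apply (r x)
    rw [h2, real_inner_self_eq_norm_sq, hnorm x (mem_ball_zero_iff.1 hx).le] at h1
    norm_num at h1
  -- All nodes lie in the range of `key`, so each integral equals the volume of the ball. The
  -- weights sum to one, so interpolation to `t = 1` gives this volume again, while `hdet0` gives
  -- zero.
  set v : ℕ → ℝ := fun i => 1 / ((C + 2) * (i + 1)) with hv_def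
  have hv : Function.Injective v := by
    intro i j hij
    have hC1 : C + 2 ≠ 0 := by positivity
    simp only [hv_def] at hij
    field_simp at hij
    exact_mod_cast (add_right_cancel hij).symm
  obtain ⟨c, hc, hsum⟩ := det_one_add_eq_sum (E := E) v hv
  have hint : ∀ t : ℝ, IntegrableOn
      (fun x => (ContinuousLinearMap.id ℝ E + t • fderiv ℝ g x).det) B μ := by
    intro t
    have : ContinuousOn (fun x => (ContinuousLinearMap.id ℝ E + t • fderiv ℝ g x).det)
        (Metric.closedBall 0 1) :=
      ContinuousLinearMap.continuous_det.comp_continuousOn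
        (continuousOn_const.add ((hfcont.mono hball).const_smul t))
    exact (this.integrableOn_compact (isCompact_closedBall 0 1)).mono_set
      Metric.ball_subset_closedBall
  have h0 : ∫ x in B, (ContinuousLinearMap.id ℝ E + fderiv ℝ g x).det ∂μ = 0 := by
    rw [setIntegral_congr_fun Metric.isOpen_ball.measurableSet hdet0, integral_zero]
  simp only [fun x => hsum (fderiv ℝ g x)] at h0
  rw [integral_finsetSum _ fun i _ => (hint _).const_mul _] at h0
  have hi : ∀ i ∈ Finset.range (Module.finrank ℝ E + 1),
      ∫ x in B, c i * (ContinuousLinearMap.id ℝ E + v i • fderiv ℝ g x).det ∂μ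
        = c i * μ.real B := by
    intro i _
    rw [integral_const_mul, key (v i) (by positivity)]
    simp only [hv_def]
    rw [div_mul_eq_mul_div, one_mul, div_le_one (by positivity)]
    nlinarith [(Nat.cast_nonneg i : (0 : ℝ) ≤ i)]
  rw [Finset.sum_congr rfl hi, ← Finset.sum_mul, hc, one_mul] at h0
  have hpos : 0 < μ.real B := by
    rw [Measure.real, ENNReal.toReal_pos_iff]
    exact ⟨Metric.measure_ball_pos μ 0 one_pos, measure_ball_lt_top⟩
  exact hpos.ne' h0

end Brouwer

/-! ### Brouwer's fixed point theorem and the variational inequality. -/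

section FixedPoint

theorem Continuous.exists_contDiff_norm_sub_le_on_closedBall {E F : Type*} [NormedAddCommGroup E]
    [NormedSpace ℝ E] [FiniteDimensional ℝ E] [NormedAddCommGroup F] [NormedSpace ℝ F]
    [CompleteSpace F] {f : E → F} (hf : Continuous f) (r : ℝ) {ε : ℝ} (hε : 0 < ε) :
    ∃ g : E → F, ContDiff ℝ 1 g ∧ ∀ x, ‖x‖ ≤ r → ‖g x - f x‖ ≤ ε := by
  -- The radius is enlarged by one so that the balls of radius `min 1 δ` around the points of
  -- interest stay in the compact set.
  have huc : UniformContinuousOn f (Metric.closedBall 0 (r + 1)) :=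
    (isCompact_closedBall _ _).uniformContinuousOn_of_continuous hf.continuousOn
  obtain ⟨δ, hδ, hfδ⟩ := Metric.uniformContinuousOn_iff.1 huc ε hε
  obtain ⟨g, hg, h⟩ :=
    hf.exists_contDiff_dist_le_of_forall_mem_ball_dist_le (lt_min one_pos hδ)
  refine ⟨g, hg.of_le (by exact_mod_cast le_top), fun x hx => ?_⟩
  rw [← dist_eq_norm]
  refine h x ε fun y hy => ?_
  rw [Metric.mem_ball, lt_min_iff] at hy
  refine (hfδ y ?_ x ?_ hy.2).le
  · rw [mem_closedBall_zero_iff]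
    have := norm_le_norm_add_norm_sub' y x
    rw [dist_eq_norm] at hy
    linarith [hy.1]
  · rw [mem_closedBall_zero_iff]; linarith

variable {E : Type*} [NormedAddCommGroup E] [InnerProductSpace ℝ E] [FiniteDimensional ℝ E]

/-- A `C¹` map whose values on the closed unit ball lie in the open unit ball has a fixed point. -/
theorem exists_fixedPoint_of_contDiff {p : E → E} (hp : ContDiff ℝ 1 p)
    (hp1 : ∀ x, ‖x‖ ≤ 1 → ‖p x‖ < 1) : ∃ x, ‖x‖ ≤ 1 ∧ p x = x := by
  by_contra! hne
  set v : E → E := fun x => x - p x with hv_def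
  have hv : ContDiff ℝ 1 v := contDiff_id.sub hp
  -- The retraction pushes `x` along `v x`, away from `p x`, to the sphere; `d` is a quarter of the
  -- discriminant of `‖x + s • v x‖ ^ 2 = 1` in `s`, and the larger root is used below.
  set d : E → ℝ := fun x => inner ℝ x (v x) ^ 2 + ‖v x‖ ^ 2 * (1 - ‖x‖ ^ 2) with hd_def
  have hd : ContDiff ℝ 1 d :=
    ((contDiff_id.inner ℝ hv).pow 2).add
      ((hv.norm_sq ℝ).mul (contDiff_const.sub (contDiff_id.norm_sq ℝ)))
  set O : Set E := {x | v x ≠ 0} ∩ {x | d x ≠ 0}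
  have hO : IsOpen O := (isOpen_ne_fun hv.continuous continuous_const).inter
    (isOpen_ne_fun hd.continuous continuous_const)
  have hv0 : ∀ x, ‖x‖ ≤ 1 → v x ≠ 0 := fun x hx h => hne x hx (sub_eq_zero.1 h).symm
  have hsph : ∀ x, ‖x‖ = 1 → 0 < inner ℝ x (v x) := by
    intro x hx
    simp only [hv_def, inner_sub_right, real_inner_self_eq_norm_sq, hx]
    have := real_inner_le_norm x (p x)
    rw [hx] at this
    linarith [hp1 x hx.le]
  have hdpos : ∀ x, ‖x‖ ≤ 1 → 0 < d x := by
    intro x hx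
    have hvx : 0 < ‖v x‖ ^ 2 := by have := norm_pos_iff.2 (hv0 x hx); positivity
    rcases hx.lt_or_eq with h | h
    · have h2 : 0 < 1 - ‖x‖ ^ 2 := by nlinarith [norm_nonneg x]
      have := mul_pos hvx h2
      simp only [hd_def]
      positivity
    · have := hsph x h
      simp only [hd_def, h]
      norm_num
      positivity
  set s : E → ℝ := fun x => (√(d x) - inner ℝ x (v x)) / ‖v x‖ ^ 2 with hs_def
  have hs : ContDiffOn ℝ 1 s O :=
    ((hd.contDiffOn.sqrt fun x hx => hx.2).sub (contDiff_id.inner ℝ hv).contDiffOn).div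
      (hv.norm_sq ℝ).contDiffOn fun x hx => by simpa using hx.1
  refine no_contDiff_retraction (r := fun x => x + s x • v x) hO ?_
    (contDiffOn_id.add (hs.smul hv.contDiffOn)) ?_ ?_
  · intro x hx
    rw [mem_closedBall_zero_iff] at hx
    exact ⟨hv0 x hx, (hdpos x hx).ne'⟩
  · intro x hx
    have : s x = 0 := by
      simp only [hs_def, hd_def, hx]
      norm_num [Real.sqrt_sq (hsph x hx).le]
    simp [this]
  · intro x hx
    have hvx : ‖v x‖ ^ 2 ≠ 0 := by have := norm_pos_iff.2 (hv0 x hx); positivity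
    have h1 : s x * ‖v x‖ ^ 2 = √(d x) - inner ℝ x (v x) := by
      exact div_mul_cancel₀ _ hvx
    have h2 : √(d x) ^ 2 = d x := Real.sq_sqrt (hdpos x hx).le
    have h3 : ‖x + s x • v x‖ ^ 2 = 1 := by
      rw [norm_add_sq_real, inner_smul_right, norm_smul, mul_pow, Real.norm_eq_abs, sq_abs]
      have h4 : (s x * ‖v x‖ ^ 2 + inner ℝ x (v x)) ^ 2 = d x := by rw [h1, sub_add_cancel, h2]
      simp only [hd_def] at h4
      apply mul_left_cancel₀ hvx
      linear_combination h4
    exact (pow_eq_one_iff_of_nonneg (norm_nonneg _) two_ne_zero).1 h3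

/-- The **Brouwer fixed point theorem** for a continuous map of the space into the unit ball. -/
theorem exists_fixedPoint_of_norm_le_one {f : E → E} (hf : Continuous f)
    (hf1 : ∀ x, ‖f x‖ ≤ 1) : ∃ x, f x = x := by
  by_contra! hne
  obtain ⟨x₀, -, hmin⟩ := (isCompact_closedBall (0 : E) 1).exists_isMinOn ⟨0, by simp⟩
    (hf.sub continuous_id).norm.continuousOn
  set ε := ‖f x₀ - x₀‖ with hε_def
  have hε : 0 < ε := norm_pos_iff.2 (sub_ne_zero.2 (hne x₀))
  -- An error of `ε / 4` and a shrinking by `1 + ε / 2` put the values in the open ball; the fixed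
  -- point then moves under `f` by at most `3ε / 4`, below the minimum `ε`.
  obtain ⟨g, hg, hgf⟩ := hf.exists_contDiff_norm_sub_le_on_closedBall 1 (ε := ε / 4) (by positivity)
  have hc : 0 < 1 + ε / 2 := by positivity
  have hgn : ∀ x, ‖x‖ ≤ 1 → ‖g x‖ ≤ 1 + ε / 4 := fun x hx => by
    have := norm_le_norm_add_norm_sub' (g x) (f x)
    linarith [hgf x hx, hf1 x]
  obtain ⟨x, hx, hpx⟩ := exists_fixedPoint_of_contDiff (p := fun x => (1 + ε / 2)⁻¹ • g x)
    (hg.const_smul _) (fun x hx => by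
      rw [norm_smul, norm_inv, Real.norm_of_nonneg hc.le, inv_mul_lt_iff₀ hc]
      linarith [hgn x hx])
  have h1 : g x = (1 + ε / 2) • x := by rw [← hpx, smul_inv_smul₀ hc.ne', hpx]
  have h2 : ε ≤ ‖f x - x‖ := hmin (by simpa using hx)
  have h3 : f x - x = (ε / 2) • x - (g x - f x) := by rw [h1]; module
  have h4 : ‖f x - x‖ ≤ ε / 2 + ε / 4 := by
    rw [h3]
    refine (norm_sub_le _ _).trans (add_le_add ?_ (hgf x hx))
    rw [norm_smul, Real.norm_of_nonneg (by positivity)]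
    nlinarith
  linarith

theorem exists_fixedPoint_of_bounded {f : E → E} (hf : Continuous f) {R : ℝ}
    (hfR : ∀ x, ‖f x‖ ≤ R) : ∃ x, f x = x := by
  set c := |R| + 1 with hc_def
  have hc : 0 < c := by positivity
  obtain ⟨x, hx⟩ := exists_fixedPoint_of_norm_le_one (f := fun x => c⁻¹ • f (c • x))
    (by fun_prop) (fun x => by
      rw [norm_smul, norm_inv, Real.norm_of_nonneg hc.le, inv_mul_le_iff₀ hc]
      linarith [hfR (c • x), le_abs_self R])
  exact ⟨c • x, (inv_smul_eq_iff₀ hc.ne').1 hx⟩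

/-- The metric projection onto a closed convex set. -/
theorem exists_continuous_projection {D : Set E} (hD : IsClosed D) (hconv : Convex ℝ D)
    (hne : D.Nonempty) : ∃ π : E → E, Continuous π ∧ (∀ x, π x ∈ D) ∧
      ∀ x, ∀ y ∈ D, inner ℝ (x - π x) (y - π x) ≤ 0 := by
  have hex : ∀ x : E, ∃ v ∈ D, ∀ y ∈ D, inner ℝ (x - v) (y - v) ≤ 0 := by
    intro x
    obtain ⟨v, hv, h⟩ := exists_norm_eq_iInf_of_complete_convex hne hD.isComplete hconv x
    exact ⟨v, hv, (norm_eq_iInf_iff_real_inner_le_zero hconv hv).1 h⟩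
  choose π hπ h using hex
  refine ⟨π, ?_, hπ, h⟩
  refine (LipschitzWith.of_dist_le_mul (K := 1) fun x y => ?_).continuous
  rw [dist_eq_norm, dist_eq_norm, NNReal.coe_one, one_mul]
  have h1 := h x (π y) (hπ y)
  have h2 := h y (π x) (hπ x)
  -- Firm nonexpansiveness: the sum of the two projection inequalities.
  have h3 : ‖π x - π y‖ ^ 2 ≤ inner ℝ (x - y) (π x - π y) := by
    have e : inner ℝ (x - y) (π x - π y) - ‖π x - π y‖ ^ 2 =
        -(inner ℝ (x - π x) (π y - π x)) - inner ℝ (y - π y) (π x - π y) := by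
      rw [← real_inner_self_eq_norm_sq, ← inner_sub_left,
        show π y - π x = -(π x - π y) by abel, inner_neg_right, neg_neg, ← inner_sub_left]
      congr 1
      abel
    linarith
  have h4 := real_inner_le_norm (x - y) (π x - π y)
  rcases (norm_nonneg (π x - π y)).eq_or_lt with h0 | h0
  · rw [← h0]; exact norm_nonneg _
  · exact le_of_mul_le_mul_right (by nlinarith) h0

/-- The variational inequality of Hartman and Stampacchia. -/
theorem exists_forall_inner_sub_nonpos {D : Set E} (hD : IsCompact D) (hconv : Convex ℝ D)
    (hne : D.Nonempty) {G : E → E} (hG : ContinuousOn G D) :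
    ∃ q ∈ D, ∀ y ∈ D, inner ℝ (G q) (y - q) ≤ 0 := by
  obtain ⟨π, hπc, hπD, hπ⟩ := exists_continuous_projection hD.isClosed hconv hne
  obtain ⟨R, hR⟩ := hD.isBounded.exists_norm_le
  have hGπ : Continuous fun x => G (π x) := hG.comp_continuous hπc hπD
  -- A fixed point lies in `D` and is the projection of `x + G x`; the projection inequality there
  -- is the claim.
  obtain ⟨x, hx⟩ := exists_fixedPoint_of_bounded (f := fun x => π (π x + G (π x)))
    (hπc.comp (hπc.add hGπ)) (R := R) (fun x => hR _ (hπD _))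
  have hxD : x ∈ D := hx ▸ hπD _
  have hπx : π x = x := by
    have := hπ x x hxD
    rw [real_inner_self_nonpos, sub_eq_zero] at this
    exact this.symm
  refine ⟨x, hxD, fun y hy => ?_⟩
  have := hπ (π x + G (π x)) y hy
  rw [hx, hπx, add_sub_cancel_left] at this
  exact this

end FixedPoint

/-! ### Gluing, shifting and continuing Carathéodory solutions. -/

section Solutions

namespace IsSolution

variable {E F : Type*} [NormedAddCommGroup E] [NormedSpace ℝ E]
  {f : E → F → E} {X : Set E} {u u' : ℝ → F} {τ σ : EReal} {x x' : ℝ → E}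

theorem mono (h : IsSolution f X u τ x) (hσ : 0 < σ) (hστ : σ ≤ τ) : IsSolution f X u σ x where
  pos := hσ
  mem t ht htσ := h.mem t ht (htσ.trans_le hστ)
  integrable t ht htσ := h.integrable t ht (htσ.trans_le hστ)
  eq_integral t ht htσ := h.eq_integral t ht (htσ.trans_le hστ)

/-- The conditions on a solution are local in time. -/
theorem of_forall_lt (hτ : 0 < τ) (H : ∀ t : ℝ, 0 ≤ t → (t : EReal) < τ →
    ∃ (σ : EReal) (y : ℝ → E) (v : ℝ → F), (t : EReal) < σ ∧ IsSolution f X v σ y ∧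
      (∀ s, 0 ≤ s → s ≤ t → y s = x s) ∧ ∀ s, 0 ≤ s → s ≤ t → v s = u s) :
    IsSolution f X u τ x := by
  have key : ∀ t : ℝ, 0 ≤ t → (t : EReal) < τ → x t ∈ X ∧
      IntervalIntegrable (fun s => f (x s) (u s)) volume 0 t ∧
      x t = x 0 + ∫ s in (0 : ℝ)..t, f (x s) (u s) := by
    intro t ht htτ
    obtain ⟨σ, y, v, htσ, hy, hyx, hvu⟩ := H t ht htτ
    have heq : EqOn (fun s => f (y s) (v s)) (fun s => f (x s) (u s)) (uIcc 0 t) := by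
      intro s hs
      rw [uIcc_of_le ht] at hs
      simp only [hyx s hs.1 hs.2, hvu s hs.1 hs.2]
    refine ⟨hyx t ht le_rfl ▸ hy.mem t ht htσ,
      (hy.integrable t ht htσ).congr (heq.mono uIoc_subset_uIcc), ?_⟩
    rw [← hyx t ht le_rfl, ← hyx 0 le_rfl ht, hy.eq_integral t ht htσ,
      intervalIntegral.integral_congr heq]
  exact ⟨hτ, fun t h1 h2 => (key t h1 h2).1, fun t h1 h2 => (key t h1 h2).2.1,
    fun t h1 h2 => (key t h1 h2).2.2⟩

theorem congr (h : IsSolution f X u τ x) (hx : ∀ t : ℝ, 0 ≤ t → (t : EReal) < τ → x' t = x t)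
    (hu : ∀ t : ℝ, 0 ≤ t → (t : EReal) < τ → u' t = u t) : IsSolution f X u' τ x' := by
  refine of_forall_lt h.pos fun t _ htτ => ⟨τ, x, u, htτ, h, fun s hs hst => ?_, fun s hs hst => ?_⟩
  · exact (hx s hs ((EReal.coe_le_coe_iff.2 hst).trans_lt htτ)).symm
  · exact (hu s hs ((EReal.coe_le_coe_iff.2 hst).trans_lt htτ)).symm

theorem continuousOn_Icc (h : IsSolution f X u τ x) {T : ℝ} (hT : 0 ≤ T) (hTτ : (T : EReal) < τ) :
    ContinuousOn x (Icc 0 T) := by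
  have h1 : ContinuousOn (fun t => x 0 + ∫ s in (0 : ℝ)..t, f (x s) (u s)) (Icc 0 T) := by
    refine continuousOn_const.add ?_
    have := intervalIntegral.continuousOn_primitive_interval
      (f := fun s => f (x s) (u s)) (a := 0) (b := T) (μ := volume) ?_
    · rwa [uIcc_of_le hT] at this
    · rw [uIcc_of_le hT, integrableOn_Icc_iff_integrableOn_Ioc,
        ← intervalIntegrable_iff_integrableOn_Ioc_of_le hT]
      exact h.integrable T hT hTτ
  exact h1.congr fun t ht => h.eq_integral t ht.1 ((EReal.coe_le_coe_iff.2 ht.2).trans_lt hTτ)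

theorem sub_eq_integral (h : IsSolution f X u τ x) {s t : ℝ} (hs : 0 ≤ s) (hst : s ≤ t)
    (ht : (t : EReal) < τ) : x t - x s = ∫ r in s..t, f (x r) (u r) := by
  have hsτ := (EReal.coe_le_coe_iff.2 hst).trans_lt ht
  rw [h.eq_integral t (hs.trans hst) ht, h.eq_integral s hs hsτ, add_sub_add_left_eq_sub,
    intervalIntegral.integral_interval_sub_left (h.integrable t (hs.trans hst) ht)
      (h.integrable s hs hsτ)]

/-- The bound is needed only before time `t`, since the endpoint is a null set. This is the form
that first-exit arguments supply. -/
theorem norm_sub_le (h : IsSolution f X u τ x) {s t M : ℝ} (hs : 0 ≤ s) (hst : s ≤ t)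
    (ht : (t : EReal) < τ) (hM : ∀ r, s ≤ r → r < t → ‖f (x r) (u r)‖ ≤ M) :
    ‖x t - x s‖ ≤ M * (t - s) := by
  rw [h.sub_eq_integral hs hst ht]
  have := intervalIntegral.norm_integral_le_of_norm_le_const_ae (a := s) (b := t) (C := M)
    (f := fun r => f (x r) (u r)) <| by
      filter_upwards [compl_mem_ae_iff.2 (measure_singleton t)] with r hrt hr
      rw [uIoc_of_le hst] at hr
      exact hM r hr.1.le (lt_of_le_of_ne hr.2 hrt)
  rwa [abs_of_nonneg (sub_nonneg.2 hst)] at this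

theorem shift (h : IsSolution f X u τ x) {s : ℝ} (hs : 0 ≤ s) (hσ : 0 < σ)
    (hσs : ∀ t : ℝ, 0 ≤ t → (t : EReal) < σ → ((s + t : ℝ) : EReal) < τ) :
    IsSolution f X (fun t => u (s + t)) σ (fun t => x (s + t)) where
  pos := hσ
  mem t ht htσ := h.mem _ (by positivity) (hσs t ht htσ)
  integrable t ht htσ := by
    have hst := hσs t ht htσ
    have h1 : IntervalIntegrable (fun r => f (x r) (u r)) volume s (s + t) :=
      (h.integrable s hs (lt_of_le_of_lt (by exact_mod_cast by linarith) hst)).symm.trans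
        (h.integrable (s + t) (by positivity) hst)
    simpa using h1.comp_add_left s
  eq_integral t ht htσ := by
    have hst := hσs t ht htσ
    have h1 := h.sub_eq_integral hs (le_add_of_nonneg_right ht) hst
    rw [intervalIntegral.integral_comp_add_left (fun r => f (x r) (u r)), add_zero, ← h1]
    abel

/-- Concatenation of a solution on `[0, T]` with a solution that starts at time `T`. -/
theorem concat {T : ℝ} (hT : 0 ≤ T) {v : ℝ → E}
    (hmem : ∀ t, 0 ≤ t → t ≤ T → x t ∈ X)
    (hint : IntervalIntegrable (fun s => f (x s) (u s)) volume 0 T)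
    (heq : ∀ t, 0 ≤ t → t ≤ T → x t = x 0 + ∫ s in (0 : ℝ)..t, f (x s) (u s))
    (hv : IsSolution f X (fun t => u (T + t)) σ v) (hvT : v 0 = x T)
    (hτ : 0 < τ) (hτσ : ∀ t : ℝ, 0 ≤ t → ((T + t : ℝ) : EReal) < τ → (t : EReal) < σ) :
    IsSolution f X u τ (fun t => if t ≤ T then x t else v (t - T)) := by
  set w : ℝ → E := fun t => if t ≤ T then x t else v (t - T) with hw
  have hwx : ∀ t ≤ T, w t = x t := fun t ht => by simp [hw, ht]
  have hwv : ∀ t, 0 ≤ t → w (T + t) = v t := by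
    intro t ht
    rcases ht.eq_or_lt with rfl | ht
    · rw [add_zero, hwx T le_rfl, hvT]
    · simp [hw, ht]
  have hintl : ∀ t, 0 ≤ t → t ≤ T → IntervalIntegrable (fun s => f (w s) (u s)) volume 0 t ∧
      w t = w 0 + ∫ s in (0 : ℝ)..t, f (w s) (u s) := by
    intro t ht htT
    have hcongr : EqOn (fun s => f (x s) (u s)) (fun s => f (w s) (u s)) (uIcc 0 t) := by
      intro s hs
      rw [uIcc_of_le ht] at hs
      simp only [hwx s (hs.2.trans htT)]
    refine ⟨IntervalIntegrable.congr (hcongr.mono uIoc_subset_uIcc)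
      (hint.mono_set ?_), ?_⟩
    · rw [uIcc_of_le ht, uIcc_of_le hT]; exact Icc_subset_Icc_right htT
    · rw [hwx t htT, hwx 0 hT, heq t ht htT, intervalIntegral.integral_congr hcongr]
  have hintr : ∀ t : ℝ, 0 ≤ t → (t : EReal) < σ →
      IntervalIntegrable (fun s => f (w s) (u s)) volume T (T + t) ∧
      ∫ s in T..(T + t), f (w s) (u s) = v t - v 0 := by
    intro t ht htσ
    have hcongr : EqOn (fun s => f (v s) (u (T + s))) (fun s => f (w (T + s)) (u (T + s)))
        (uIcc 0 t) := by
      intro s hs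
      rw [uIcc_of_le ht] at hs
      simp only [hwv s hs.1]
    constructor
    · have h1 := IntervalIntegrable.congr (hcongr.mono uIoc_subset_uIcc) (hv.integrable t ht htσ)
      have h2 := h1.comp_add_left (-T)
      simpa [add_comm] using h2
    · have h1 := intervalIntegral.integral_comp_add_left (a := 0) (b := t)
        (fun r => f (w r) (u r)) T
      rw [add_zero] at h1
      rw [← h1, ← intervalIntegral.integral_congr hcongr, hv.eq_integral t ht htσ,
        add_sub_cancel_left]
  have hcase : ∀ t, T ≤ t → ∃ r, 0 ≤ r ∧ t = T + r := fun t ht =>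
    ⟨t - T, sub_nonneg.2 ht, by ring⟩
  refine ⟨hτ, fun t ht htτ => ?_, fun t ht htτ => ?_, fun t ht htτ => ?_⟩
  · rcases le_total t T with h | h
    · rw [hwx t h]; exact hmem t ht h
    · obtain ⟨r, hr, rfl⟩ := hcase t h
      rw [hwv r hr]; exact hv.mem r hr (hτσ r hr htτ)
  · rcases le_total t T with h | h
    · exact (hintl t ht h).1
    · obtain ⟨r, hr, rfl⟩ := hcase t h
      exact (hintl T hT le_rfl).1.trans (hintr r hr (hτσ r hr htτ)).1
  · rcases le_total t T with h | h
    · exact (hintl t ht h).2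
    · obtain ⟨r, hr, rfl⟩ := hcase t h
      have hr' := hintr r hr (hτσ r hr htτ)
      rw [← intervalIntegral.integral_add_adjacent_intervals (hintl T hT le_rfl).1 hr'.1, hr'.2,
        ← add_assoc, ← (hintl T hT le_rfl).2, hwv r hr, hwx T le_rfl, hvT]
      abel

/-- A solution on `[0, T)` with bounded derivative can be continued beyond `T`. -/
theorem extend [CompleteSpace E] (hX : IsClosed X) {T M : ℝ} (h : IsSolution f X u T x)
    (hM : ∀ t, 0 ≤ t → t < T → ‖f (x t) (u t)‖ ≤ M)
    (hloc : ∀ p ∈ X, ∃ σ : ℝ, 0 < σ ∧ ∃ v, IsSolution f X (fun t => u (T + t)) σ v ∧ v 0 = p) :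
    ∃ σ : ℝ, 0 < σ ∧ ∃ w, IsSolution f X u ((T + σ : ℝ) : EReal) w ∧
      ∀ t, 0 ≤ t → t < T → w t = x t := by
  have hT : 0 < T := by exact_mod_cast h.pos
  have hM0 : 0 ≤ M := (norm_nonneg _).trans (hM 0 le_rfl hT)
  -- Times increasing to `T`; uniformly bounded integrals up to `b n` give integrability up to `T`.
  set b : ℕ → ℝ := fun n => T - T / (n + 1) with hb
  have hb0 : ∀ n, 0 ≤ b n := fun n => by
    have : T / (n + 1) ≤ T := div_le_self hT.le (by linarith [(Nat.cast_nonneg n : (0 : ℝ) ≤ n)])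
    simp only [hb]; linarith
  have hbT : ∀ n, b n < T := fun n => by
    have : 0 < T / ((n : ℝ) + 1) := by positivity
    simp only [hb]; linarith
  have hblim : Tendsto b atTop (𝓝 T) := by
    have := (tendsto_one_div_add_atTop_nhds_zero_nat (𝕜 := ℝ)).const_mul T
    have := this.const_sub T
    simpa [hb, div_eq_mul_inv] using this
  have hint : IntervalIntegrable (fun s => f (x s) (u s)) volume 0 T := by
    rw [intervalIntegrable_iff_integrableOn_Ioc_of_le hT.le]
    refine integrableOn_Ioc_of_intervalIntegral_norm_bounded_right (I := M * T) (b := b)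
      (l := atTop) (fun n => ?_) hblim (Eventually.of_forall fun n => ?_)
    · rw [← intervalIntegrable_iff_integrableOn_Ioc_of_le (hb0 n)]
      exact h.integrable _ (hb0 n) (by exact_mod_cast hbT n)
    · have h1 := intervalIntegral.norm_integral_le_of_norm_le_const (a := 0) (b := b n) (C := M)
        (f := fun r => ‖f (x r) (u r)‖) fun r hr => by
          rw [uIoc_of_le (hb0 n)] at hr
          rw [norm_norm]
          exact hM r hr.1.le (hr.2.trans_lt (hbT n))
      rw [sub_zero, abs_of_nonneg (hb0 n), intervalIntegral.integral_of_le (hb0 n)] at h1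
      refine (le_abs_self _).trans (h1.trans ?_)
      gcongr
      exact (hbT n).le
  -- The value `x T` is arbitrary, as `x` solves only on `[0, T)`. The primitive `y` agrees with `x`
  -- before `T` and supplies the correct limit at `T`.
  set y : ℝ → E := fun t => x 0 + ∫ s in (0 : ℝ)..t, f (x s) (u s) with hy
  have hyx : ∀ t, 0 ≤ t → t < T → y t = x t := fun t ht htT =>
    (h.eq_integral t ht (by exact_mod_cast htT)).symm
  have hycont : ContinuousOn y (Icc 0 T) := by
    refine continuousOn_const.add ?_
    have := intervalIntegral.continuousOn_primitive_interval
      (f := fun s => f (x s) (u s)) (a := 0) (b := T) (μ := volume) ?_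
    · rwa [uIcc_of_le hT.le] at this
    · rwa [uIcc_of_le hT.le, integrableOn_Icc_iff_integrableOn_Ioc,
        ← intervalIntegrable_iff_integrableOn_Ioc_of_le hT.le]
  have hyT : y T ∈ X := by
    have h1 : Tendsto (fun n => y (b n)) atTop (𝓝 (y T)) :=
      (hycont T ⟨hT.le, le_rfl⟩).tendsto.comp (tendsto_nhdsWithin_iff.2
        ⟨hblim, Eventually.of_forall fun n => ⟨hb0 n, (hbT n).le⟩⟩)
    refine hX.mem_of_tendsto h1 (Eventually.of_forall fun n => ?_)
    rw [hyx _ (hb0 n) (hbT n)]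
    exact h.mem _ (hb0 n) (by exact_mod_cast hbT n)
  obtain ⟨σ, hσ, v, hv, hv0⟩ := hloc _ hyT
  have hae : ∀ t, 0 ≤ t → t ≤ T → ∀ᵐ s ∂volume, s ∈ uIoc 0 t →
      f (x s) (u s) = f (y s) (u s) := by
    intro t ht htT
    filter_upwards [compl_mem_ae_iff.2 (measure_singleton T)] with s hsT hs
    rw [uIoc_of_le ht] at hs
    rw [hyx s hs.1.le (lt_of_le_of_ne (hs.2.trans htT) hsT)]
  refine ⟨σ, hσ, _, concat (x := y) (σ := σ) hT.le ?_ ?_ ?_ hv hv0 (by exact_mod_cast by positivity) ?_, ?_⟩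
  · intro t ht htT
    rcases htT.lt_or_eq with hlt | rfl
    · rw [hyx t ht hlt]; exact h.mem t ht (by exact_mod_cast hlt)
    · exact hyT
  · exact hint.congr_ae ((ae_restrict_iff' measurableSet_uIoc).2 (hae T hT.le le_rfl))
  · intro t ht htT
    rw [← intervalIntegral.integral_congr_ae (hae t ht htT)]
    simp [hy]
  · intro t ht htσ
    norm_cast at htσ ⊢
    linarith
  · intro t ht htT
    rw [if_pos htT.le, hyx t ht htT]

/-- Every solution is dominated by one that has no proper continuation. -/
theorem exists_maximal {x₀ : E} (h : IsSolution f X u τ x) (hx₀ : x 0 = x₀) :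
    ∃ (σ : EReal) (y : ℝ → E), IsSolution f X u σ y ∧ y 0 = x₀ ∧
      ∀ (σ' : EReal) (y' : ℝ → E), IsSolution f X u σ' y' → σ ≤ σ' →
        (∀ t : ℝ, 0 ≤ t → (t : EReal) < σ → y' t = y t) → σ' ≤ σ := by
  classical
  -- Zorn's lemma for continuation. Values outside the interval of existence are ignored, so the
  -- relation is only a preorder; chains are bounded by gluing.
  let S := {p : EReal × (ℝ → E) // IsSolution f X u p.1 p.2 ∧ p.2 0 = x₀}
  let r : S → S → Prop := fun p q =>
    p.1.1 ≤ q.1.1 ∧ ∀ t : ℝ, 0 ≤ t → (t : EReal) < p.1.1 → q.1.2 t = p.1.2 t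
  have htrans : ∀ {a b c : S}, r a b → r b c → r a c := fun hab hbc =>
    ⟨hab.1.trans hbc.1, fun t ht hta =>
      (hbc.2 t ht (hta.trans_le hab.1)).trans (hab.2 t ht hta)⟩
  have hne : Nonempty S := ⟨⟨(τ, x), h, hx₀⟩⟩
  have hchain : ∀ c : Set S, IsChain r c → c.Nonempty → ∃ ub, ∀ a ∈ c, r a ub := by
    intro c hc hcne
    obtain ⟨p₀, hp₀⟩ := hcne
    set s : EReal := ⨆ p ∈ c, p.1.1 with hs
    have hle : ∀ p ∈ c, p.1.1 ≤ s := fun p hp => le_iSup₂ (f := fun (p : S) (_ : p ∈ c) => p.1.1) p hp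
    have hlt : ∀ t : ℝ, (t : EReal) < s → ∃ p ∈ c, (t : EReal) < p.1.1 := fun t ht => by
      simpa [hs, lt_iSup_iff] using ht
    let z : ℝ → E := fun t => if ht : (t : EReal) < s then (hlt t ht).choose.1.2 t else 0
    have hz : ∀ p ∈ c, ∀ t : ℝ, 0 ≤ t → (t : EReal) < p.1.1 → z t = p.1.2 t := by
      intro p hp t ht htp
      have hts : (t : EReal) < s := htp.trans_le (hle p hp)
      have hq := (hlt t hts).choose_spec
      simp only [z, dif_pos hts]
      rcases eq_or_ne (hlt t hts).choose p with e | e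
      · rw [e]
      · rcases hc hq.1 hp e with h1 | h1
        · exact (h1.2 t ht hq.2).symm
        · exact h1.2 t ht htp
    have hspos : 0 < s := p₀.2.1.pos.trans_le (hle p₀ hp₀)
    refine ⟨⟨(s, z), of_forall_lt hspos fun t ht hts => ?_, ?_⟩, fun p hp => ⟨hle p hp, hz p hp⟩⟩
    · obtain ⟨p, hp, htp⟩ := hlt t hts
      exact ⟨p.1.1, p.1.2, u, htp, p.2.1, fun s hs hst =>
        (hz p hp s hs ((EReal.coe_le_coe_iff.2 hst).trans_lt htp)).symm, fun _ _ _ => rfl⟩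
    · rw [← p₀.2.2]; exact hz p₀ hp₀ 0 le_rfl p₀.2.1.pos
  obtain ⟨m, hm⟩ := exists_maximal_of_nonempty_chains_bounded (r := r) hchain htrans
  refine ⟨m.1.1, m.1.2, m.2.1, m.2.2, fun σ' y' hy' hle hag => ?_⟩
  exact (hm ⟨(σ', y'), hy', (hag 0 le_rfl m.2.1.pos).trans m.2.2⟩ ⟨hle, hag⟩).1

end IsSolution

variable {E F : Type*} [NormedAddCommGroup E] [NormedSpace ℝ E] [CompleteSpace E]
  {f : E → F → E} {X : Set E} {u : ℝ → F}

/-- Local existence and a priori bounds give existence on the whole time interval. -/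
theorem exists_isSolution_of_apriori_bound (hX : IsClosed X)
    (hloc : ∀ s : ℝ, 0 ≤ s → ∀ p ∈ X, ∃ σ : ℝ, 0 < σ ∧
      ∃ v, IsSolution f X (fun t => u (s + t)) σ v ∧ v 0 = p)
    {x₀ : E} (hx₀ : x₀ ∈ X) {τ : EReal} (hτ : 0 < τ)
    (hb : ∀ T : ℝ, (T : EReal) < τ → ∀ x, IsSolution f X u T x → x 0 = x₀ →
      ∃ M, ∀ t, 0 ≤ t → t < T → ‖f (x t) (u t)‖ ≤ M) :
    ∃ x, IsSolution f X u τ x ∧ x 0 = x₀ := by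
  obtain ⟨σ₀, hσ₀, v, hv, hv0⟩ := hloc 0 le_rfl x₀ hx₀
  simp only [zero_add] at hv
  obtain ⟨σ, y, hy, hy0, hmax⟩ := hv.exists_maximal hv0
  rcases le_or_gt τ σ with h | h
  · exact ⟨y, hy.mono hτ h, hy0⟩
  · exfalso
    lift σ to ℝ using ⟨h.ne_top, (EReal.bot_lt_zero.trans hy.pos).ne'⟩
    have hσ : 0 < σ := by exact_mod_cast hy.pos
    obtain ⟨M, hM⟩ := hb σ h y hy hy0
    obtain ⟨η, hη, w, hw, hwy⟩ := hy.extend hX hM (hloc σ hσ.le)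
    have := hmax _ w hw (by exact_mod_cast by linarith) fun t ht htσ =>
      hwy t ht (by exact_mod_cast htσ)
    norm_cast at this
    linarith

end Solutions

/-! ### Compactness and limits of solutions. -/

section Compactness

/-- Arzelà–Ascoli for sequences of curves with a common Lipschitz constant. -/
theorem exists_subseq_tendsto_of_lipschitzOnWith {V : Type*} [MetricSpace V] {S : Set V}
    (hS : IsCompact S) {C : NNReal} {T : ℝ} {y : ℕ → ℝ → V}
    (hmem : ∀ n, ∀ t ∈ Icc 0 T, y n t ∈ S) (hlip : ∀ n, LipschitzOnWith C (y n) (Icc 0 T)) :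
    ∃ (φ : ℕ → ℕ) (z : ℝ → V), StrictMono φ ∧ LipschitzOnWith C z (Icc 0 T) ∧
      (∀ t ∈ Icc 0 T, z t ∈ S) ∧
      ∀ t ∈ Icc 0 T, Tendsto (fun n => y (φ n) t) atTop (𝓝 (z t)) := by
  classical
  -- The Lipschitz bound and membership in `S` pass to limits, so this equicontinuous family is
  -- closed and Arzelà–Ascoli applies.
  let A : Set (BoundedContinuousFunction (Icc (0 : ℝ) T) V) :=
    {g | LipschitzWith C g ∧ ∀ t, g t ∈ S}
  have hev : ∀ t : Icc (0 : ℝ) T,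
      Continuous fun g : BoundedContinuousFunction (Icc (0 : ℝ) T) V => g t :=
    fun t => continuous_eval_const t
  have hAclosed : IsClosed A := by
    have : A = (⋂ s, ⋂ t, {g | dist (g s) (g t) ≤ C * dist s t}) ∩ ⋂ t, {g | g t ∈ S} := by
      ext g
      simp only [A, lipschitzWith_iff_dist_le_mul, mem_ofPred_eq, mem_inter_iff, mem_iInter]
    rw [this]
    refine (isClosed_iInter fun s => isClosed_iInter fun t =>
      isClosed_le ((hev s).dist (hev t)) continuous_const).inter
      (isClosed_iInter fun t => hS.isClosed.preimage (hev t))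
  have hAcompact : IsCompact A := by
    refine BoundedContinuousFunction.arzela_ascoli₂ S hS A hAclosed (fun g t hg => hg.2 t) ?_
    exact (LipschitzWith.uniformEquicontinuous _ C fun g : A => g.2.1).equicontinuous
  let g : ℕ → BoundedContinuousFunction (Icc (0 : ℝ) T) V := fun n =>
    BoundedContinuousFunction.mkOfCompact ⟨_, (hlip n).to_restrict.continuous⟩
  obtain ⟨G, hG, φ, hφ, hlim⟩ := hAcompact.tendsto_subseq (x := g)
    fun n => ⟨(hlip n).to_restrict, fun t => hmem n t t.2⟩
  refine ⟨φ, fun t => if ht : t ∈ Icc 0 T then G ⟨t, ht⟩ else y 0 t, hφ, ?_, ?_, ?_⟩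
  · intro s hs t ht
    simp only [dif_pos hs, dif_pos ht]
    exact hG.1 ⟨s, hs⟩ ⟨t, ht⟩
  · intro t ht
    simp only [dif_pos ht]
    exact hG.2 _
  · intro t ht
    simp only [dif_pos ht]
    exact ((hev ⟨t, ht⟩).tendsto G).comp hlim

variable {E F : Type*} [NormedAddCommGroup E] [NormedSpace ℝ E] [TopologicalSpace F]
  {f : E → F → E} {X : Set E} {U : Set F}

/-- Limits of solutions are solutions. -/
theorem IsSolution.of_tendsto (hf : ContinuousOn (Function.uncurry f) (X ×ˢ U)) {T M : ℝ}
    (hT : 0 < T) {x : ℕ → ℝ → E} {u : ℕ → ℝ → F} {y : ℝ → E} {v : ℝ → F}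
    {σ : ℕ → EReal} (hσ : ∀ n, (T : EReal) < σ n) (hx : ∀ n, IsSolution f X (u n) (σ n) (x n))
    (hM : ∀ n, ∀ t ∈ Icc 0 T, ‖f (x n t) (u n t)‖ ≤ M)
    (hu : ∀ n, ∀ t ∈ Icc 0 T, u n t ∈ U)
    (hy : ∀ t ∈ Icc 0 T, y t ∈ X) (hv : ∀ t ∈ Icc 0 T, v t ∈ U)
    (hyc : ContinuousOn y (Icc 0 T)) (hvc : ContinuousOn v (Icc 0 T))
    (hxy : ∀ t ∈ Icc 0 T, Tendsto (fun n => x n t) atTop (𝓝 (y t)))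
    (huv : ∀ t ∈ Icc 0 T, Tendsto (fun n => u n t) atTop (𝓝 (v t))) :
    IsSolution f X v T y := by
  have hfc : ContinuousOn (fun s => f (y s) (v s)) (Icc 0 T) :=
    hf.comp (hyc.prodMk hvc) fun t ht => ⟨hy t ht, hv t ht⟩
  have hlt : ∀ n, ∀ t ∈ Icc 0 T, (t : EReal) < σ n := fun n t ht =>
    (EReal.coe_le_coe_iff.2 ht.2).trans_lt (hσ n)
  refine ⟨by exact_mod_cast hT, fun t ht htT => hy t ⟨ht, by exact_mod_cast htT.le⟩, ?_, ?_⟩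
  · intro t ht htT
    have htT' : t ≤ T := by exact_mod_cast htT.le
    refine (hfc.mono ?_).intervalIntegrable
    rw [uIcc_of_le ht]
    exact Icc_subset_Icc_right htT'
  · intro t ht htT
    have htT' : t ≤ T := by exact_mod_cast htT.le
    have h1 : Tendsto (fun n => ∫ s in (0 : ℝ)..t, f (x n s) (u n s)) atTop
        (𝓝 (∫ s in (0 : ℝ)..t, f (y s) (v s))) := by
      refine intervalIntegral.tendsto_integral_filter_of_dominated_convergence (fun _ => M)
        (Eventually.of_forall fun n => ?_) (Eventually.of_forall fun n => ?_)
        intervalIntegrable_const ?_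
      · rw [uIoc_of_le ht]
        exact ((hx n).integrable t ht (hlt n t ⟨ht, htT'⟩)).aestronglyMeasurable
      · refine Eventually.of_forall fun s hs => ?_
        rw [uIoc_of_le ht] at hs
        exact hM n s ⟨hs.1.le, hs.2.trans htT'⟩
      · refine Eventually.of_forall fun s hs => ?_
        rw [uIoc_of_le ht] at hs
        have hsT : s ∈ Icc 0 T := ⟨hs.1.le, hs.2.trans htT'⟩
        refine (hf (y s, v s) ⟨hy s hsT, hv s hsT⟩).tendsto.comp
          (tendsto_nhdsWithin_iff.2 ⟨(hxy s hsT).prodMk_nhds (huv s hsT),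
            Eventually.of_forall fun n => ⟨(hx n).mem s hsT.1 (hlt n s hsT), hu n s hsT⟩⟩)
    refine tendsto_nhds_unique (hxy t ⟨ht, htT'⟩) ?_
    refine ((hxy 0 ⟨le_rfl, hT.le⟩).add h1).congr fun n => ?_
    exact ((hx n).eq_integral t ht (hlt n t ⟨ht, htT'⟩)).symm

end Compactness

/-! ### Existence times for the open loop. -/

section OpenLoop

variable {E F : Type*} [NormedAddCommGroup E] [NormedSpace ℝ E]
  {f : E → F → E} {X : Set E}

/-- While the derivative is bounded by `M` on the ball of radius `r`, a solution does not leave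
this ball before the time `r / M`. -/
theorem IsSolution.norm_sub_le_of_bound {u : ℝ → F} {τ : EReal} {x : ℝ → E}
    (h : IsSolution f X u τ x) {r M : ℝ} (hr : 0 < r)
    (hM : ∀ t : ℝ, 0 ≤ t → (t : EReal) < τ → ‖x t - x 0‖ ≤ r → ‖f (x t) (u t)‖ ≤ M)
    {t : ℝ} (ht : 0 ≤ t) (htτ : (t : EReal) < τ) (htM : M * t < r) : ‖x t - x 0‖ ≤ r := by
  by_contra! hlt
  have hc := (h.continuousOn_Icc ht htτ)
  have hM0 : 0 ≤ M := (norm_nonneg _).trans (hM 0 le_rfl h.pos (by simpa using hr.le))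
  have hcn : ContinuousOn (fun s => ‖x s - x 0‖) (Icc 0 t) := (hc.sub continuousOn_const).norm
  have hSc : IsCompact (Icc 0 t ∩ (fun s => ‖x s - x 0‖) ⁻¹' Ici r) :=
    isCompact_Icc.of_isClosed_subset (hcn.preimage_isClosed_of_isClosed isClosed_Icc isClosed_Ici)
      inter_subset_left
  -- At the first time `s` of distance at least `r`, the speed bound gives `r ≤ M * s ≤ M * t < r`.
  obtain ⟨s, ⟨hs, hsr⟩, hmin⟩ := hSc.exists_isLeast ⟨t, ⟨ht, le_rfl⟩, hlt.le⟩
  have hsτ : (s : EReal) < τ := (EReal.coe_le_coe_iff.2 hs.2).trans_lt htτ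
  have h1 := h.norm_sub_le (M := M) le_rfl hs.1 hsτ fun q hq hqs => by
    refine hM q hq ((EReal.coe_le_coe_iff.2 hqs.le).trans_lt hsτ) ?_
    by_contra! hlt'
    exact absurd (hmin ⟨⟨hq, hqs.le.trans hs.2⟩, hlt'.le⟩) (not_le.2 hqs)
  have h2 : r ≤ ‖x s - x 0‖ := hsr
  have h3 : M * s ≤ M * t := by gcongr; exact hs.2
  linarith

variable [CompleteSpace E] [NormedAddCommGroup F] [MeasurableSpace F] {U : Set F}

theorem IsInput.comp_add_left [BorelSpace F] {u : ℝ → F} (hu : IsInput U u) {s : ℝ} (hs : 0 ≤ s) :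
    IsInput U fun t => u (s + t) where
  measurable := hu.measurable.comp (measurable_const_add s)
  mem t ht := hu.mem _ (by positivity)
  locallyBounded T := by
    refine (hu.locallyBounded (s + T)).subset ?_
    rintro _ ⟨t, ht, rfl⟩
    exact ⟨s + t, ⟨by linarith [ht.1], by linarith [ht.2]⟩, rfl⟩

theorem IsInput.of_continuous [BorelSpace F] {u : ℝ → F} (hu : Continuous u)
    (hmem : ∀ t, 0 ≤ t → u t ∈ U) : IsInput U u where
  measurable := hu.measurable
  mem := hmem
  locallyBounded _ := (isCompact_Icc.image hu).isBounded

/-- A lower bound for the existence time of the solutions with a given input. -/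
theorem IsWellPosed.exists_isSolution_of_bound [BorelSpace F] (hwp : IsWellPosed f X U)
    (hX : IsClosed X) {u : ℝ → F} (hu : IsInput U u) {x₀ : E} (hx₀ : x₀ ∈ X) {r M : ℝ} (hr : 0 < r)
    (hM0 : 0 < M) (hM : ∀ p ∈ X, ‖p - x₀‖ ≤ r → ∀ t, 0 ≤ t → ‖f p (u t)‖ ≤ M) :
    ∃ x, IsSolution f X u ((r / M : ℝ) : EReal) x ∧ x 0 = x₀ ∧
      ∀ t, 0 ≤ t → t < r / M → ‖x t - x₀‖ ≤ r := by
  have hball : ∀ (T : EReal) x, T ≤ (r / M : ℝ) → IsSolution f X u T x → x 0 = x₀ →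
      ∀ t : ℝ, 0 ≤ t → (t : EReal) < T → ‖x t - x₀‖ ≤ r := by
    rintro T x hT hx rfl t ht htT
    have htr : t < r / M := by exact_mod_cast htT.trans_le hT
    refine hx.norm_sub_le_of_bound (M := M) hr
      (fun s hs hsT hsr => hM _ (hx.mem s hs hsT) hsr s hs) ht htT ?_
    rw [lt_div_iff₀ hM0] at htr
    linarith
  have hloc : ∀ s : ℝ, 0 ≤ s → ∀ p ∈ X, ∃ σ : ℝ, 0 < σ ∧
      ∃ v, IsSolution f X (fun t => u (s + t)) σ v ∧ v 0 = p := by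
    intro s hs p hp
    obtain ⟨τ, v, hv, hv0⟩ := hwp.exists_solution _ (hu.comp_add_left hs) p hp
    obtain ⟨σ, hσ, hστ⟩ := EReal.lt_iff_exists_real_btwn.1 hv.pos
    exact ⟨σ, by exact_mod_cast hσ, v, hv.mono hσ hστ.le, hv0⟩
  obtain ⟨x, hx, hx0⟩ := exists_isSolution_of_apriori_bound (τ := ((r / M : ℝ) : EReal)) hX hloc hx₀
    (by exact_mod_cast by positivity) fun T hT x hx hx0 => ⟨M, fun t ht htT =>
      hM _ (hx.mem t ht (by exact_mod_cast htT))
        (hball T x hT.le hx hx0 t ht (by exact_mod_cast htT)) t ht⟩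
  exact ⟨x, hx, hx0, fun t ht htr => hball _ x le_rfl hx hx0 t ht (by exact_mod_cast htr)⟩

end OpenLoop

/-! ### Existence for the extended closed loop inside an invariant set. -/

section ClosedLoop

/-- The vector field of the extended closed loop. -/
def extendedField {E F : Type*} (f : E → F → E) (h : E → F) (p : E × E) (_ : Unit) : E × E :=
  (f p.1 (h p.2), f p.2 (h p.1))

theorem continuousOn_extendedField {E F : Type*} [TopologicalSpace E] [TopologicalSpace F]
    {f : E → F → E} {h : E → F} {X : Set E} {U : Set F}
    (hf : ContinuousOn (Function.uncurry f) (X ×ˢ U)) (hh : ContinuousOn h X) (hhU : MapsTo h X U) :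
    ContinuousOn (fun p => extendedField f h p ()) (X ×ˢ X) := by
  have h1 : ContinuousOn (fun p : E × E => f p.1 (h p.2)) (X ×ˢ X) :=
    hf.comp (continuousOn_fst.prodMk (hh.comp continuousOn_snd fun p hp => hp.2))
      fun p hp => ⟨hp.1, hhU hp.2⟩
  have h2 : ContinuousOn (fun p : E × E => f p.2 (h p.1)) (X ×ˢ X) :=
    hf.comp (continuousOn_snd.prodMk (hh.comp continuousOn_fst fun p hp => hp.1))
      fun p hp => ⟨hp.2, hhU hp.1⟩
  exact h1.prodMk h2

/-- The field of the extended closed loop is bounded on bounded sets. -/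
theorem exists_bound_extendedField {E F : Type*} [NormedAddCommGroup E] [ProperSpace E]
    [TopologicalSpace F] {f : E → F → E} {h : E → F} {X : Set E} {U : Set F}
    (hX : IsClosed X) (hf : ContinuousOn (Function.uncurry f) (X ×ˢ U)) (hh : ContinuousOn h X)
    (hhU : MapsTo h X U) {S : Set (E × E)} (hS : Bornology.IsBounded S) (hSX : S ⊆ X ×ˢ X) :
    ∃ M : ℝ, 0 < M ∧ ∀ p ∈ S, ‖extendedField f h p ()‖ ≤ M := by
  have hcl : closure S ⊆ X ×ˢ X := closure_minimal hSX (hX.prod hX)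
  obtain ⟨M, hM⟩ := hS.isCompact_closure.exists_bound_of_continuousOn
    ((continuousOn_extendedField hf hh hhU).mono hcl)
  exact ⟨max M 1, by positivity, fun p hp => (hM p (subset_closure hp)).trans (le_max_left _ _)⟩

/-- Open-loop solutions whose inputs come from curves in `A` do not leave `A`. -/
def LoopInvariant {E F : Type*} [NormedAddCommGroup E] [NormedSpace ℝ E]
    (f : E → F → E) (h : E → F) (X : Set E) (A : Set (E × E)) : Prop :=
  ∀ c : ℝ → E × E, Continuous c → (∀ t, c t ∈ A) → ∀ (τ : EReal) (x z : ℝ → E),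
    IsSolution f X (fun t => h (c t).2) τ x → IsSolution f X (fun t => h (c t).1) τ z →
    (x 0, z 0) ∈ A → ∀ t : ℝ, 0 ≤ t → (t : EReal) < τ → (x t, z t) ∈ A

variable {E F : Type*} [NormedAddCommGroup E] [NormedSpace ℝ E]
  {f : E → F → E} {h : E → F} {X : Set E} {A : Set (E × E)}

theorem IsSolution.isExtendedSolution [CompleteSpace E] {τ : EReal} {y : ℝ → E × E}
    (hy : IsSolution (extendedField f h) A (fun _ => ()) τ y) (hA : A ⊆ X ×ˢ X) :
    IsExtendedSolution f h X τ (fun t => (y t).1) (fun t => (y t).2) := by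
  refine ⟨⟨hy.pos, fun t ht htτ => (hA (hy.mem t ht htτ)).1, fun t ht htτ => ?_,
    fun t ht htτ => ?_⟩, ⟨hy.pos, fun t ht htτ => (hA (hy.mem t ht htτ)).2, fun t ht htτ => ?_,
    fun t ht htτ => ?_⟩⟩
  · exact ⟨(hy.integrable t ht htτ).1.fst, (hy.integrable t ht htτ).2.fst⟩
  · have h1 := (ContinuousLinearMap.fst ℝ E E).intervalIntegral_comp_comm (hy.integrable t ht htτ)
    have h2 := congrArg Prod.fst (hy.eq_integral t ht htτ)
    exact h2.trans (congrArg (fun w => (y 0).1 + w) h1.symm)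
  · exact ⟨(hy.integrable t ht htτ).1.snd, (hy.integrable t ht htτ).2.snd⟩
  · have h1 := (ContinuousLinearMap.snd ℝ E E).intervalIntegral_comp_comm (hy.integrable t ht htτ)
    have h2 := congrArg Prod.snd (hy.eq_integral t ht htτ)
    exact h2.trans (congrArg (fun w => (y 0).2 + w) h1.symm)

theorem IsExtendedSolution.isSolution [CompleteSpace E] {τ : EReal} {x z : ℝ → E}
    (hxz : IsExtendedSolution f h X τ x z)
    (hA : ∀ t : ℝ, 0 ≤ t → (t : EReal) < τ → (x t, z t) ∈ A) :
    IsSolution (extendedField f h) A (fun _ => ()) τ (fun t => (x t, z t)) := by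
  obtain ⟨hx, hz⟩ := hxz
  have hint : ∀ t : ℝ, 0 ≤ t → (t : EReal) < τ → IntervalIntegrable
      (fun s => extendedField f h (x s, z s) ()) volume 0 t := fun t ht htτ =>
    ⟨(hx.integrable t ht htτ).1.prodMk (hz.integrable t ht htτ).1,
      (hx.integrable t ht htτ).2.prodMk (hz.integrable t ht htτ).2⟩
  refine ⟨hx.pos, hA, hint, fun t ht htτ => ?_⟩
  have h1 := (ContinuousLinearMap.fst ℝ E E).intervalIntegral_comp_comm (hint t ht htτ)
  have h2 := (ContinuousLinearMap.snd ℝ E E).intervalIntegral_comp_comm (hint t ht htτ)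
  refine Prod.ext ?_ ?_
  · exact (hx.eq_integral t ht htτ).trans (congrArg (fun w => x 0 + w) h1)
  · exact (hz.eq_integral t ht htτ).trans (congrArg (fun w => z 0 + w) h2)

variable [ProperSpace E] [NormedAddCommGroup F] [MeasurableSpace F] [BorelSpace F] {U : Set F}

/-- The open-loop response, frozen outside `[0, η]`, to the input given by a curve in `A`. -/
theorem exists_response (hX : IsClosed X) (hwp : IsWellPosed f X U) (hh : ContinuousOn h X)
    (hhU : MapsTo h X U) (hAX : A ⊆ X ×ˢ X) (hinv : LoopInvariant f h X A) {q : E × E} (hq : q ∈ A)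
    {M η : ℝ} (hM0 : 0 < M) (hη : 0 < η) (hηM : η < 1 / M)
    (hM : ∀ p ∈ X ×ˢ X, ‖p - q‖ ≤ 1 → ‖extendedField f h p ()‖ ≤ M)
    {c : ℝ → E × E} (hc : Continuous c) (hcA : ∀ t, c t ∈ A) (hcq : ∀ t, ‖c t - q‖ ≤ 1) :
    ∃ c' : ℝ → E × E, LipschitzWith M.toNNReal c' ∧ (∀ t, c' t ∈ A) ∧ (∀ t, ‖c' t - q‖ ≤ 1) ∧
      (∀ t ≤ 0, c' t = q) ∧ IsSolution f X (fun t => h (c t).2) η (fun t => (c' t).1) ∧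
      IsSolution f X (fun t => h (c t).1) η (fun t => (c' t).2) := by
  have hcX : ∀ t, c t ∈ X ×ˢ X := fun t => hAX (hcA t)
  have hu2 : IsInput U fun t => h (c t).2 :=
    .of_continuous (hh.comp_continuous hc.snd fun t => (hcX t).2) fun t _ => hhU (hcX t).2
  have hu1 : IsInput U fun t => h (c t).1 :=
    .of_continuous (hh.comp_continuous hc.fst fun t => (hcX t).1) fun t _ => hhU (hcX t).1
  -- The product carries the maximum norm, so a pair mixing a response component with an input
  -- component is still within distance one of `q`.
  have hb1 : ∀ p ∈ X, ‖p - q.1‖ ≤ 1 → ∀ t, 0 ≤ t → ‖f p (h (c t).2)‖ ≤ M := fun p hp hpq t _ =>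
    (norm_fst_le _).trans (hM (p, (c t).2) ⟨hp, (hcX t).2⟩
      (max_le hpq ((norm_snd_le (c t - q)).trans (hcq t))))
  have hb2 : ∀ p ∈ X, ‖p - q.2‖ ≤ 1 → ∀ t, 0 ≤ t → ‖f p (h (c t).1)‖ ≤ M := fun p hp hpq t _ =>
    (norm_snd_le _).trans (hM ((c t).1, p) ⟨(hcX t).1, hp⟩
      (max_le ((norm_fst_le (c t - q)).trans (hcq t)) hpq))
  obtain ⟨x, hx, hx0, hxq⟩ := hwp.exists_isSolution_of_bound hX hu2 (hAX hq).1 one_pos hM0 hb1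
  obtain ⟨z, hz, hz0, hzq⟩ := hwp.exists_isSolution_of_bound hX hu1 (hAX hq).2 one_pos hM0 hb2
  have hlt : ∀ t ≤ η, (t : EReal) < ((1 / M : ℝ) : EReal) := fun t ht => by
    exact_mod_cast ht.trans_lt hηM
  have hlip : ∀ {u : ℝ → F} {w : ℝ → E} {w₀ : E}, IsSolution f X u ((1 / M : ℝ) : EReal) w →
      (∀ t, 0 ≤ t → t < 1 / M → ‖w t - w₀‖ ≤ 1) →
      (∀ p ∈ X, ‖p - w₀‖ ≤ 1 → ∀ t, 0 ≤ t → ‖f p (u t)‖ ≤ M) →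
      LipschitzOnWith M.toNNReal w (Icc 0 η) := by
    intro u w w₀ hw hwq hb
    have key : ∀ s ∈ Icc 0 η, ∀ t ∈ Icc 0 η, s ≤ t → dist (w t) (w s) ≤ M * dist t s := by
      intro s hs t ht hst
      rw [dist_eq_norm, Real.dist_eq, abs_of_nonneg (sub_nonneg.2 hst)]
      refine hw.norm_sub_le hs.1 hst (hlt t ht.2) fun r hr hrt => ?_
      have h0 := hs.1.trans hr
      have h1 := hlt r (hrt.le.trans ht.2)
      exact hb _ (hw.mem r h0 h1) (hwq r h0 (by exact_mod_cast h1)) r h0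
    refine LipschitzOnWith.of_dist_le_mul fun s hs t ht => ?_
    rw [Real.coe_toNNReal _ hM0.le]
    rcases le_total s t with hst | hst
    · rw [dist_comm, dist_comm s]; exact key s hs t ht hst
    · exact key t ht s hs hst
  have hy : LipschitzOnWith M.toNNReal (fun t => (x t, z t)) (Icc 0 η) := by
    have := (hlip hx hxq hb1).prodMk (hlip hz hzq hb2)
    rwa [max_self] at this
  have hyA : ∀ t ∈ Icc 0 η, (x t, z t) ∈ A := fun t ht =>
    hinv c hc hcA _ x z hx hz (by rw [hx0, hz0]; exact hq) t ht.1 (hlt t ht.2)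
  let π : ℝ → ℝ := fun t => (projIcc 0 η hη.le t : ℝ)
  have hπ : ∀ t, π t ∈ Icc 0 η := fun t => (projIcc 0 η hη.le t).2
  have hπid : ∀ t ∈ Icc 0 η, π t = t := fun t ht => by
    simp only [π, projIcc_of_mem hη.le ht]
  have hσ : ((η : ℝ) : EReal) ≤ ((1 / M : ℝ) : EReal) := (hlt η le_rfl).le
  have hη' : (0 : EReal) < η := by exact_mod_cast hη
  refine ⟨fun t => (x (π t), z (π t)), ?_, fun t => hyA _ (hπ t), fun t => ?_, fun t ht => ?_,
    (hx.mono hη' hσ).congr (fun t ht htη => ?_) fun _ _ _ => rfl,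
    (hz.mono hη' hσ).congr (fun t ht htη => ?_) fun _ _ _ => rfl⟩
  · have := hy.to_restrict.comp (LipschitzWith.projIcc hη.le)
    rwa [mul_one] at this
  · have h1 := hlt _ (hπ t).2
    norm_cast at h1
    exact max_le (hxq _ (hπ t).1 h1) (hzq _ (hπ t).1 h1)
  · have : π t = 0 := by simp only [π, projIcc_of_le_left hη.le ht]
    simp only [this, hx0, hz0]
  · simp only [hπid t ⟨ht, by exact_mod_cast htη.le⟩]
  · simp only [hπid t ⟨ht, by exact_mod_cast htη.le⟩]

/-- Solutions of the closed loop with a delay in the feedback. -/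
theorem exists_delayedSolution (hX : IsClosed X) (hwp : IsWellPosed f X U) (hh : ContinuousOn h X)
    (hhU : MapsTo h X U) (hAX : A ⊆ X ×ˢ X) (hinv : LoopInvariant f h X A) {q : E × E} (hq : q ∈ A)
    {M η : ℝ} (hM0 : 0 < M) (hη : 0 < η) (hηM : η < 1 / M)
    (hM : ∀ p ∈ X ×ˢ X, ‖p - q‖ ≤ 1 → ‖extendedField f h p ()‖ ≤ M) {δ : ℝ} (hδ : 0 < δ) :
    ∃ c : ℝ → E × E, LipschitzWith M.toNNReal c ∧ (∀ t, c t ∈ A) ∧ (∀ t, ‖c t - q‖ ≤ 1) ∧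
      c 0 = q ∧ IsSolution f X (fun t => h (c (t - δ)).2) η (fun t => (c t).1) ∧
      IsSolution f X (fun t => h (c (t - δ)).1) η (fun t => (c t).2) := by
  -- The method of steps as an iteration: each curve is sent to the response to its copy delayed by
  -- `δ`, with the constant history `q`.
  let S := {c : ℝ → E × E // LipschitzWith M.toNNReal c ∧ (∀ t, c t ∈ A) ∧
    (∀ t, ‖c t - q‖ ≤ 1) ∧ ∀ t ≤ 0, c t = q}
  have hstep : ∀ c : S, ∃ c' : S,
      IsSolution f X (fun t => h (c.1 (t - δ)).2) η (fun t => (c'.1 t).1) ∧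
      IsSolution f X (fun t => h (c.1 (t - δ)).1) η (fun t => (c'.1 t).2) := by
    rintro ⟨c, hcl, hcA, hcq, hc0⟩
    obtain ⟨c', h1, h2, h3, h4, h5, h6⟩ := exists_response hX hwp hh hhU hAX hinv hq hM0 hη hηM hM
      (c := fun t => c (t - δ)) (hcl.continuous.comp (continuous_id.sub continuous_const))
      (fun t => hcA _) (fun t => hcq _)
    exact ⟨⟨c', h1, h2, h3, h4⟩, h5, h6⟩
  choose step hstep using hstep
  let c₀ : S := ⟨fun _ => q, LipschitzWith.const' q, fun _ => hq, fun _ => by simp, fun _ _ => rfl⟩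
  let c : ℕ → S := fun k => step^[k] c₀
  have hcs : ∀ k, c (k + 1) = step (c k) := fun k => Function.iterate_succ_apply' step k c₀
  have hcX : ∀ k t, (c k).1 t ∈ X ×ˢ X := fun k t => hAX ((c k).2.2.1 t)
  have hcc : ∀ k, Continuous fun t => (c k).1 (t - δ) := fun k =>
    (c k).2.1.continuous.comp (continuous_id.sub continuous_const)
  have hu2 : ∀ k, IsInput U fun t => h ((c k).1 (t - δ)).2 := fun k =>
    .of_continuous (hh.comp_continuous (hcc k).snd fun t => (hcX k _).2) fun t _ => hhU (hcX k _).2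
  have hu1 : ∀ k, IsInput U fun t => h ((c k).1 (t - δ)).1 := fun k =>
    .of_continuous (hh.comp_continuous (hcc k).fst fun t => (hcX k _).1) fun t _ => hhU (hcX k _).1
  -- Each iteration gains one delay: agreement before `k * δ` makes the delayed inputs agree before
  -- `(k + 1) * δ`, and open-loop uniqueness transfers this to the responses.
  have hagree : ∀ k : ℕ, ∀ t, t < k * δ → t < η → (c (k + 1)).1 t = (c k).1 t := by
    intro k
    induction k with
    | zero =>
      intro t ht _
      have ht' : t ≤ 0 := by simpa using ht.le
      rw [(c _).2.2.2.2 t ht', (c _).2.2.2.2 t ht']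
    | succ k ih =>
      intro t ht htη
      rcases le_or_gt t 0 with ht0 | ht0
      · rw [(c _).2.2.2.2 t ht0, (c _).2.2.2.2 t ht0]
      have hs1 := hstep (c (k + 1))
      have hs2 := hstep (c k)
      rw [← hcs] at hs1 hs2
      set σ : ℝ := min η ((k + 1 : ℕ) * δ) with hσ
      have hσ0 : (0 : EReal) < σ := by
        have : 0 < σ := lt_min hη (by positivity)
        exact_mod_cast this
      have hση : (σ : EReal) ≤ η := by exact_mod_cast min_le_left _ _
      have hin : ∀ s : ℝ, 0 ≤ s → (s : EReal) < σ → (c (k + 1)).1 (s - δ) = (c k).1 (s - δ) := by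
        intro s _ hs
        have hs' : s < σ := by exact_mod_cast hs
        refine ih (s - δ) ?_ ?_
        · have := hs'.trans_le (min_le_right _ _)
          push_cast at this
          linarith
        · linarith [hs'.trans_le (min_le_left _ _)]
      have h0 : (c (k + 1 + 1)).1 0 = (c (k + 1)).1 0 := by
        rw [(c _).2.2.2.2 0 le_rfl, (c _).2.2.2.2 0 le_rfl]
      have htσ : (t : EReal) < σ := by exact_mod_cast lt_min htη ht
      refine Prod.ext ?_ ?_
      · exact hwp.unique _ (hu2 k) σ _ _ ((hs1.1.mono hσ0 hση).congr (fun _ _ _ => rfl)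
          fun s hs hsσ => by rw [hin s hs hsσ]) (hs2.1.mono hσ0 hση)
          (congrArg Prod.fst h0) t ht0.le htσ
      · exact hwp.unique _ (hu1 k) σ _ _ ((hs1.2.mono hσ0 hση).congr (fun _ _ _ => rfl)
          fun s hs hsσ => by rw [hin s hs hsσ]) (hs2.2.mono hσ0 hση)
          (congrArg Prod.snd h0) t ht0.le htσ
  -- Once `N * δ > η`, the iterates `N` and `N + 1` agree before `η`, so the latter is driven by its
  -- own delayed copy.
  obtain ⟨N, hN⟩ := exists_nat_gt (η / δ)
  rw [div_lt_iff₀ hδ] at hN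
  have hs := hstep (c N)
  rw [← hcs] at hs
  have hin : ∀ s : ℝ, 0 ≤ s → (s : EReal) < η → (c (N + 1)).1 (s - δ) = (c N).1 (s - δ) := by
    intro s _ hs
    have hs' : s < η := by exact_mod_cast hs
    exact hagree N _ (by linarith) (by linarith)
  exact ⟨(c (N + 1)).1, (c _).2.1, (c _).2.2.1, (c _).2.2.2.1, (c _).2.2.2.2 0 le_rfl,
    hs.1.congr (fun _ _ _ => rfl) fun s hs hsη => by rw [hin s hs hsη],
    hs.2.congr (fun _ _ _ => rfl) fun s hs hsη => by rw [hin s hs hsη]⟩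

/-- Local existence for the extended closed loop. -/
theorem exists_isSolution_extendedField_local (hX : IsClosed X)
    (hf : ContinuousOn (Function.uncurry f) (X ×ˢ U)) (hwp : IsWellPosed f X U)
    (hh : ContinuousOn h X) (hhU : MapsTo h X U) (hA : IsClosed A) (hAX : A ⊆ X ×ˢ X)
    (hinv : LoopInvariant f h X A) {q : E × E} (hq : q ∈ A) :
    ∃ σ : ℝ, 0 < σ ∧ ∃ y, IsSolution (extendedField f h) A (fun _ => ()) σ y ∧ y 0 = q := by
  obtain ⟨M, hM0, hM'⟩ := exists_bound_extendedField hX hf hh hhU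
    (S := Metric.closedBall q 1 ∩ X ×ˢ X)
    (Metric.isBounded_closedBall.subset inter_subset_left) inter_subset_right
  have hM : ∀ p ∈ X ×ˢ X, ‖p - q‖ ≤ 1 → ‖extendedField f h p ()‖ ≤ M := fun p hp hpq =>
    hM' p ⟨by rwa [Metric.mem_closedBall, dist_eq_norm], hp⟩
  set η := 1 / (2 * M) with hη_def
  have hη : 0 < η := by positivity
  have hηM : η < 1 / M := one_div_lt_one_div_of_lt hM0 (by linarith)
  -- As the delays tend to zero, the curves stay in a fixed compact set with common Lipschitz
  -- constant `M`; a subsequential limit solves the undelayed loop. The limit is taken on `[0, η /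
  -- 2]`, strictly inside the existence interval.
  set δ : ℕ → ℝ := fun n => 1 / ((n : ℝ) + 1) with hδ_def
  have hδ : ∀ n, 0 < δ n := fun n => by positivity
  have hδlim : Tendsto δ atTop (𝓝 0) := tendsto_one_div_add_atTop_nhds_zero_nat
  choose c hcl hcA hcq hc0 hc1 hc2 using fun n =>
    exists_delayedSolution hX hwp hh hhU hAX hinv hq hM0 hη hηM hM (hδ n)
  set T := η / 2 with hT_def
  have hT : 0 < T := by positivity
  have hTη : (T : EReal) < η := by exact_mod_cast half_lt_self hη
  have hS : IsCompact (A ∩ Metric.closedBall q 1) := (isCompact_closedBall q 1).inter_left hA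
  obtain ⟨φ, y, hφ, hyl, hyS, hlim⟩ := exists_subseq_tendsto_of_lipschitzOnWith (T := T) hS
    (fun n t _ => ⟨hcA n t, by rw [Metric.mem_closedBall, dist_eq_norm]; exact hcq n t⟩)
    fun n => (hcl n).lipschitzOnWith
  have hyX : ∀ t ∈ Icc 0 T, y t ∈ X ×ˢ X := fun t ht => hAX (hyS t ht).1
  have hdel : ∀ t ∈ Icc 0 T, Tendsto (fun n => c (φ n) (t - δ (φ n))) atTop (𝓝 (y t)) := by
    intro t ht
    refine (tendsto_iff_of_dist ?_).1 (hlim t ht)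
    refine squeeze_zero (g := fun n => M * δ (φ n)) (fun n => dist_nonneg) (fun n => ?_) ?_
    · have := (hcl (φ n)).dist_le_mul t (t - δ (φ n))
      rwa [Real.coe_toNNReal _ hM0.le, dist_self_sub_right, Real.norm_of_nonneg (hδ _).le] at this
    · simpa using (hδlim.comp hφ.tendsto_atTop).const_mul M
  have hyc : ContinuousOn y (Icc 0 T) := hyl.continuousOn
  have hh2 : ∀ t ∈ Icc 0 T,
      Tendsto (fun n => h (c (φ n) (t - δ (φ n))).2) atTop (𝓝 (h (y t).2)) := fun t ht =>
    (hh _ (hyX t ht).2).tendsto.comp (tendsto_nhdsWithin_iff.2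
      ⟨((continuous_snd.tendsto _).comp (hdel t ht)),
        Eventually.of_forall fun n => (hAX (hcA _ _)).2⟩)
  have hh1 : ∀ t ∈ Icc 0 T,
      Tendsto (fun n => h (c (φ n) (t - δ (φ n))).1) atTop (𝓝 (h (y t).1)) := fun t ht =>
    (hh _ (hyX t ht).1).tendsto.comp (tendsto_nhdsWithin_iff.2
      ⟨((continuous_fst.tendsto _).comp (hdel t ht)),
        Eventually.of_forall fun n => (hAX (hcA _ _)).1⟩)
  have hb : ∀ n s t, ‖f (c n s).1 (h (c n t).2)‖ ≤ M ∧ ‖f (c n s).2 (h (c n t).1)‖ ≤ M := by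
    intro n s t
    constructor
    · exact (norm_fst_le _).trans (hM ((c n s).1, (c n t).2)
        ⟨(hAX (hcA _ _)).1, (hAX (hcA _ _)).2⟩
        (max_le ((norm_fst_le (c n s - q)).trans (hcq n s)) ((norm_snd_le (c n t - q)).trans (hcq n t))))
    · exact (norm_snd_le _).trans (hM ((c n t).1, (c n s).2)
        ⟨(hAX (hcA _ _)).1, (hAX (hcA _ _)).2⟩
        (max_le ((norm_fst_le (c n t - q)).trans (hcq n t)) ((norm_snd_le (c n s - q)).trans (hcq n s))))
  have hs1 : IsSolution f X (fun t => h (y t).2) T (fun t => (y t).1) :=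
    IsSolution.of_tendsto hf hT (fun _ => hTη) (fun n => hc1 (φ n)) (fun n t _ => (hb _ _ _).1)
      (fun n t _ => hhU (hAX (hcA _ _)).2) (fun t ht => (hyX t ht).1)
      (fun t ht => hhU (hyX t ht).2) (continuous_fst.comp_continuousOn hyc)
      (hh.comp (continuous_snd.comp_continuousOn hyc) fun t ht => (hyX t ht).2)
      (fun t ht => (continuous_fst.tendsto _).comp (hlim t ht)) hh2
  have hs2 : IsSolution f X (fun t => h (y t).1) T (fun t => (y t).2) :=
    IsSolution.of_tendsto hf hT (fun _ => hTη) (fun n => hc2 (φ n)) (fun n t _ => (hb _ _ _).2)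
      (fun n t _ => hhU (hAX (hcA _ _)).1) (fun t ht => (hyX t ht).2)
      (fun t ht => hhU (hyX t ht).1) (continuous_snd.comp_continuousOn hyc)
      (hh.comp (continuous_fst.comp_continuousOn hyc) fun t ht => (hyX t ht).1)
      (fun t ht => (continuous_snd.tendsto _).comp (hlim t ht)) hh1
  refine ⟨T, hT, y, IsExtendedSolution.isSolution ⟨hs1, hs2⟩ fun t ht htT =>
    (hyS t ⟨ht, by exact_mod_cast htT.le⟩).1, ?_⟩
  exact tendsto_nhds_unique (hlim 0 ⟨le_rfl, hT.le⟩) (by simp [hc0])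

/-- Global existence for the extended closed loop if its solutions are bounded. -/
theorem exists_isSolution_extendedField_global (hX : IsClosed X)
    (hf : ContinuousOn (Function.uncurry f) (X ×ˢ U)) (hwp : IsWellPosed f X U)
    (hh : ContinuousOn h X) (hhU : MapsTo h X U) (hA : IsClosed A) (hAX : A ⊆ X ×ˢ X)
    (hinv : LoopInvariant f h X A)
    (hB : ∀ (τ : EReal) (x z : ℝ → E), IsExtendedSolution f h X τ x z →
      Bornology.IsBounded ((fun t => (x t, z t)) '' {t : ℝ | 0 ≤ t ∧ (t : EReal) < τ}))
    {q : E × E} (hq : q ∈ A) :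
    ∃ y, IsSolution (extendedField f h) A (fun _ => ()) ⊤ y ∧ y 0 = q := by
  refine exists_isSolution_of_apriori_bound hA
    (fun s _ p hp => exists_isSolution_extendedField_local hX hf hwp hh hhU hA hAX hinv hp) hq
    EReal.zero_lt_top fun T _ y hy _ => ?_
  have hbdd := hB _ _ _ (hy.isExtendedSolution hAX)
  obtain ⟨M, -, hM⟩ := exists_bound_extendedField hX hf hh hhU hbdd (by
    rintro _ ⟨t, ⟨ht, htT⟩, rfl⟩
    exact hAX (hy.mem t ht htT))
  exact ⟨M, fun t ht htT => hM _ ⟨t, ⟨ht, by exact_mod_cast htT⟩, rfl⟩⟩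

end ClosedLoop

/-! ### Limit sets, the mixed order and invariant order sets. -/

section LimitSets

/-- The product order in which the extended closed loop of an anti-monotone system is monotone. -/
def mixedLE {E : Type*} [NormedAddCommGroup E] [NormedSpace ℝ E] (K : ProperCone ℝ E)
    (p q : E × E) : Prop :=
  coneLE K p.1 q.1 ∧ coneLE K q.2 p.2

/-- Each point of `W` is reached, after any given time, by a solution of the extended closed loop
in `W`. -/
def IsBackwardInvariant {E F : Type*} [NormedAddCommGroup E] [NormedSpace ℝ E]
    (f : E → F → E) (h : E → F) (X : Set E) (W : Set (E × E)) : Prop :=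
  ∀ w ∈ W, ∀ T : ℝ, 0 ≤ T → ∃ v : ℝ → E × E, Continuous v ∧ (∀ t, v t ∈ W) ∧ v T = w ∧
    IsExtendedSolution f h X ((T + 1 : ℝ) : EReal) (fun t => (v t).1) (fun t => (v t).2)

variable {E F : Type*} [NormedAddCommGroup E] [NormedSpace ℝ E]
  {f : E → F → E} {h : E → F} {X : Set E}

theorem LoopInvariant.inter {A B : Set (E × E)} (hA : LoopInvariant f h X A)
    (hB : LoopInvariant f h X B) : LoopInvariant f h X (A ∩ B) :=
  fun c hc hcAB τ x z hx hz h0 t ht htτ =>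
    ⟨hA c hc (fun s => (hcAB s).1) τ x z hx hz h0.1 t ht htτ,
      hB c hc (fun s => (hcAB s).2) τ x z hx hz h0.2 t ht htτ⟩

theorem isClosed_setOf_coneLE {α : Type*} [TopologicalSpace α] (K : ProperCone ℝ E) {g g' : α → E}
    (hg : Continuous g) (hg' : Continuous g') : IsClosed {a | coneLE K (g a) (g' a)} :=
  K.isClosed.preimage (hg'.sub hg)

theorem isClosed_setOf_forall_mixedLE (K : ProperCone ℝ E) (W : Set (E × E)) :
    IsClosed {q : E × E | ∀ w ∈ W, mixedLE K q w} := by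
  simp only [ofPred_forall]
  exact isClosed_biInter fun w _ => (isClosed_setOf_coneLE K continuous_fst continuous_const).inter
    (isClosed_setOf_coneLE K continuous_const continuous_snd)

theorem isClosed_setOf_forall_mixedLE' (K : ProperCone ℝ E) (W : Set (E × E)) :
    IsClosed {q : E × E | ∀ w ∈ W, mixedLE K w q} := by
  simp only [ofPred_forall]
  exact isClosed_biInter fun w _ => (isClosed_setOf_coneLE K continuous_const continuous_fst).inter
    (isClosed_setOf_coneLE K continuous_snd continuous_const)

theorem coneLE.convexComb {K : ProperCone ℝ E} {x y x' y' : E} (hx : coneLE K x x')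
    (hy : coneLE K y y') {a b : ℝ} (ha : 0 ≤ a) (hb : 0 ≤ b) (hab : a + b = 1) :
    coneLE K (a • x + b • y) (a • x' + b • y') := by
  have := K.convex hx hy ha hb hab
  have e : a • (x' - x) + b • (y' - y) = (a • x' + b • y') - (a • x + b • y) := by module
  rw [e] at this
  exact this

theorem convex_setOf_forall_mixedLE (K : ProperCone ℝ E) (W : Set (E × E)) :
    Convex ℝ {q : E × E | ∀ w ∈ W, mixedLE K q w} := by
  intro p hp q hq a b ha hb hab w hw
  have e := Convex.combo_self hab w
  have h1 := (hp w hw).1.convexComb (hq w hw).1 ha hb hab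
  have h2 := (hp w hw).2.convexComb (hq w hw).2 ha hb hab
  rw [← e]
  exact ⟨h1, h2⟩

theorem convex_setOf_forall_mixedLE' (K : ProperCone ℝ E) (W : Set (E × E)) :
    Convex ℝ {q : E × E | ∀ w ∈ W, mixedLE K w q} := by
  intro p hp q hq a b ha hb hab w hw
  have e := Convex.combo_self hab w
  have h1 := (hp w hw).1.convexComb (hq w hw).1 ha hb hab
  have h2 := (hp w hw).2.convexComb (hq w hw).2 ha hb hab
  rw [← e]
  exact ⟨h1, h2⟩

/-- A closed pointed cone in a finite-dimensional space is normal. -/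
theorem ProperCone.exists_norm_le_of_coneLE [ProperSpace E] {K : ProperCone ℝ E}
    (hK : ∀ v ∈ K, -v ∈ K → v = 0) :
    ∃ C : ℝ, ∀ v w : E, coneLE K 0 v → coneLE K v w → ‖v‖ ≤ C * ‖w‖ := by
  by_cases hne : (Metric.sphere (0 : E) 1 ∩ K).Nonempty
  · have hKne : (K : Set E).Nonempty := ⟨0, K.zero_mem⟩
    have hS : IsCompact (Metric.sphere (0 : E) 1 ∩ K) := (isCompact_sphere 0 1).inter_right K.isClosed
    -- By compactness and pointedness, the negatives of unit vectors of `K` stay at distance at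
    -- least some `ε > 0` from `K`. Scaling `v` to norm one and using `w - v ∈ K` turns this into `ε
    -- * ‖v‖ ≤ ‖w‖`.
    obtain ⟨v₀, ⟨hv₀, hv₀K⟩, hmin⟩ := hS.exists_isMinOn hne
      ((Metric.continuous_infDist_pt (K : Set E)).comp continuous_neg).continuousOn
    set ε := Metric.infDist (-v₀) (K : Set E) with hε
    have hε0 : 0 < ε := by
      rw [hε, ← K.isClosed.notMem_iff_infDist_pos hKne]
      intro hneg
      rw [hK v₀ hv₀K hneg] at hv₀
      simp at hv₀
    refine ⟨ε⁻¹, fun v w hv hvw => ?_⟩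
    have hvK : v ∈ K := by simpa [coneLE] using hv
    rcases eq_or_ne v 0 with rfl | hv0
    · simp only [norm_zero]; positivity
    have hvn : 0 < ‖v‖ := norm_pos_iff.2 hv0
    have hi : 0 ≤ ‖v‖⁻¹ := by positivity
    have h1 : ε ≤ Metric.infDist (-(‖v‖⁻¹ • v)) (K : Set E) :=
      hmin (a := ‖v‖⁻¹ • v) ⟨by simp [norm_smul, hvn.ne'], K.smul_mem hvK hi⟩
    have h2 : Metric.infDist (-(‖v‖⁻¹ • v)) (K : Set E) ≤
        dist (-(‖v‖⁻¹ • v)) (‖v‖⁻¹ • (w - v)) :=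
      Metric.infDist_le_dist_of_mem (K.smul_mem hvw hi)
    have h3 : dist (-(‖v‖⁻¹ • v)) (‖v‖⁻¹ • (w - v)) = ‖v‖⁻¹ * ‖w‖ := by
      rw [dist_eq_norm, ← norm_neg,
        show -(-(‖v‖⁻¹ • v) - ‖v‖⁻¹ • (w - v)) = ‖v‖⁻¹ • w by module, norm_smul,
        Real.norm_of_nonneg hi]
    have h4 : ε ≤ ‖v‖⁻¹ * ‖w‖ := h1.trans (h2.trans_eq h3)
    rw [inv_mul_eq_div, le_div_iff₀ hvn] at h4
    rwa [inv_mul_eq_div, le_div_iff₀ hε0, mul_comm]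
  · refine ⟨0, fun v w hv _ => ?_⟩
    have hvK : v ∈ K := by simpa [coneLE] using hv
    rw [zero_mul]
    by_contra! hvn
    exact hne ⟨‖v‖⁻¹ • v, by simp [norm_smul, hvn.ne'],
      K.smul_mem hvK (inv_nonneg.2 (norm_nonneg v))⟩

theorem isBounded_setOf_mixedLE [ProperSpace E] {K : ProperCone ℝ E}
    (hK : ∀ v ∈ K, -v ∈ K → v = 0) (p q : E × E) :
    Bornology.IsBounded {r : E × E | mixedLE K p r ∧ mixedLE K r q} := by
  obtain ⟨C, hC⟩ := ProperCone.exists_norm_le_of_coneLE hK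
  have key : ∀ a b x : E, coneLE K a x → coneLE K x b → ‖x‖ ≤ ‖a‖ + C * ‖b - a‖ := by
    intro a b x hax hxb
    have h1 := hC (x - a) (b - a) (by simpa [coneLE] using hax) (by simpa [coneLE] using hxb)
    have h2 := norm_le_norm_add_norm_sub' x a
    linarith
  refine isBounded_iff_forall_norm_le.2
    ⟨max (‖p.1‖ + C * ‖q.1 - p.1‖) (‖q.2‖ + C * ‖p.2 - q.2‖), fun r hr => ?_⟩
  exact max_le_max (key _ _ _ hr.1.1 hr.2.1) (key _ _ _ hr.2.2 hr.1.2)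

/-- The limit set of a bounded solution of the extended closed loop is backward invariant. -/
theorem isBackwardInvariant_setOf_mapClusterPt [ProperSpace E] [TopologicalSpace F] {U : Set F}
    (hX : IsClosed X) (hf : ContinuousOn (Function.uncurry f) (X ×ˢ U)) (hh : ContinuousOn h X)
    (hhU : MapsTo h X U) {y : ℝ → E × E}
    (hy : IsSolution (extendedField f h) (X ×ˢ X) (fun _ => ()) ⊤ y)
    (hb : Bornology.IsBounded (y '' Ici 0)) :
    IsBackwardInvariant f h X {w | MapClusterPt w atTop y} := by
  intro w hw T hT
  have hyX : ∀ t, 0 ≤ t → y t ∈ X ×ˢ X := fun t ht => hy.mem t ht (EReal.coe_lt_top t)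
  have hSX : y '' Ici 0 ⊆ X ×ˢ X := by rintro _ ⟨t, ht, rfl⟩; exact hyX t ht
  obtain ⟨M, hM0, hM⟩ := exists_bound_extendedField hX hf hh hhU hb hSX
  have hMt : ∀ t, 0 ≤ t → ‖extendedField f h (y t) ()‖ ≤ M := fun t ht => hM _ ⟨t, ht, rfl⟩
  -- Shifting the orbit so that time `T` corresponds to `s n`, where `y` is close to `w`, gives
  -- curves whose limit passes through `w` at `T`. The window reaches `T + 1` because solution
  -- intervals are half-open.
  have hseq : ∀ n : ℕ, ∃ t : ℝ, T + n ≤ t ∧ dist (y t) w < 1 / ((n : ℝ) + 1) := by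
    intro n
    have h1 : ∃ᶠ t in atTop, y t ∈ Metric.ball w (1 / ((n : ℝ) + 1)) :=
      MapClusterPt.frequently hw (Metric.ball_mem_nhds w (by positivity))
    obtain ⟨t, ht, ht'⟩ := (h1.and_eventually (eventually_ge_atTop (T + n))).exists
    exact ⟨t, ht', ht⟩
  choose s hs hsw using hseq
  have hs0 : ∀ n, 0 ≤ s n - T := fun n => by
    linarith [hs n, (Nat.cast_nonneg n : (0 : ℝ) ≤ n)]
  have hslim : Tendsto s atTop atTop :=
    tendsto_atTop_mono (fun n => by linarith [hs n] : ∀ n : ℕ, (n : ℝ) ≤ s n)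
      tendsto_natCast_atTop_atTop
  have hsol : ∀ n, IsSolution (extendedField f h) (X ×ˢ X) (fun _ => ()) ⊤
      (fun t => y (s n - T + t)) := fun n =>
    hy.shift (hs0 n) EReal.zero_lt_top fun t _ _ => EReal.coe_lt_top _
  have hlip : ∀ n, LipschitzOnWith M.toNNReal (fun t => y (s n - T + t)) (Icc 0 (T + 1)) := by
    intro n
    have key : ∀ a ∈ Icc 0 (T + 1), ∀ b ∈ Icc 0 (T + 1), a ≤ b →
        dist (y (s n - T + b)) (y (s n - T + a)) ≤ M * dist b a := by
      intro a ha b hb hab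
      rw [dist_eq_norm, Real.dist_eq, abs_of_nonneg (sub_nonneg.2 hab)]
      exact (hsol n).norm_sub_le ha.1 hab (EReal.coe_lt_top _) fun r hr _ =>
        hMt _ (add_nonneg (hs0 n) (ha.1.trans hr))
    refine LipschitzOnWith.of_dist_le_mul fun a ha b hb => ?_
    rw [Real.coe_toNNReal _ hM0.le]
    rcases le_total a b with hab | hab
    · rw [dist_comm, dist_comm a]; exact key a ha b hb hab
    · exact key b hb a ha hab
  have hcl : closure (y '' Ici 0) ⊆ X ×ˢ X := closure_minimal hSX (hX.prod hX)
  obtain ⟨φ, z, hφ, hzl, hzS, hlim⟩ := exists_subseq_tendsto_of_lipschitzOnWith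
    hb.isCompact_closure
    (fun n t ht => subset_closure ⟨_, add_nonneg (hs0 n) ht.1, rfl⟩) hlip
  have hT1 : (0 : ℝ) < T + 1 := by linarith
  have hzX : ∀ t ∈ Icc 0 (T + 1), z t ∈ X ×ˢ X := fun t ht => hcl (hzS t ht)
  have hzW : ∀ t ∈ Icc 0 (T + 1), MapClusterPt (z t) atTop y := by
    intro t ht
    refine MapClusterPt.of_comp (φ := fun n => s (φ n) - T + t) (p := atTop) ?_
      (hlim t ht).mapClusterPt
    simp only [sub_add_eq_add_sub, add_sub_assoc]
    exact tendsto_atTop_add_const_right _ _ (hslim.comp hφ.tendsto_atTop)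
  have hzT : z T = w := by
    have h1 : Tendsto (fun n => y (s (φ n))) atTop (𝓝 w) := by
      have h2 : Tendsto (fun n => y (s n)) atTop (𝓝 w) := by
        rw [tendsto_iff_dist_tendsto_zero]
        exact squeeze_zero (fun _ => dist_nonneg) (fun n => (hsw n).le)
          tendsto_one_div_add_atTop_nhds_zero_nat
      exact h2.comp hφ.tendsto_atTop
    refine tendsto_nhds_unique (hlim T ⟨hT, by linarith⟩) ?_
    simpa using h1
  have hzc : ContinuousOn z (Icc 0 (T + 1)) := hzl.continuousOn
  have hsolz : IsSolution (extendedField f h) (X ×ˢ X) (fun _ => ()) ((T + 1 : ℝ) : EReal) z := by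
    refine IsSolution.of_tendsto (U := univ) (M := M) ?_ hT1 (fun _ => EReal.coe_lt_top _)
      (fun n => hsol (φ n)) (fun n t ht => hMt _ (add_nonneg (hs0 _) ht.1)) (fun _ _ _ => mem_univ _)
      hzX (fun _ _ => mem_univ _) hzc continuousOn_const hlim fun _ _ => tendsto_const_nhds
    exact (continuousOn_extendedField hf hh hhU).comp continuousOn_fst fun p hp => hp.1
  -- Clamping time makes the curve continuous on all of `ℝ` with values in the limit set, so that it
  -- induces an admissible input.
  let v : ℝ → E × E := fun t => z (projIcc 0 (T + 1) hT1.le t)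
  have hv : ∀ t ∈ Icc 0 (T + 1), v t = z t := fun t ht => by simp only [v, projIcc_of_mem _ ht]
  refine ⟨v, hzc.domRestrict.comp continuous_projIcc, fun t => hzW _ (Subtype.coe_prop _),
    (hv T ⟨hT, by linarith⟩).trans hzT, ?_⟩
  exact IsSolution.isExtendedSolution (hsolz.congr
    (fun t ht htT => hv t ⟨ht, by exact_mod_cast htT.le⟩) fun _ _ _ => rfl) Subset.rfl

variable [NormedAddCommGroup F] [NormedSpace ℝ F] [MeasurableSpace F] [BorelSpace F] {U : Set F}
  {K : ProperCone ℝ E} {L : ProperCone ℝ F}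

/-- The points below a backward invariant set form an invariant set. -/
theorem IsBackwardInvariant.loopInvariant_lower {W : Set (E × E)}
    (hW : IsBackwardInvariant f h X W) (hWX : W ⊆ X ×ˢ X) (hh : ContinuousOn h X)
    (hhU : MapsTo h X U) (hanti : IsIOAntiMonotone f h X U K L) :
    LoopInvariant f h X (X ×ˢ X ∩ {q | ∀ w ∈ W, mixedLE K q w}) := by
  intro c hc hcA τ x z hx hz h0 t ht htτ
  refine ⟨⟨hx.mem t ht htτ, hz.mem t ht htτ⟩, fun w hw => ?_⟩
  -- The point `w` is reached at time `t` by a solution `v` inside `W`. The curve `c` is below all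
  -- of `W`, hence below `v` at every time; `h` reverses this into ordered inputs, and open-loop
  -- monotonicity compares the states.
  obtain ⟨v, hvc, hvW, rfl, hv1, hv2⟩ := hW w hw t ht
  have hcX : ∀ t, c t ∈ X ×ˢ X := fun t => (hcA t).1
  have hvX : ∀ t, v t ∈ X ×ˢ X := fun t => hWX (hvW t)
  have hin1 : ∀ {c : ℝ → E × E}, Continuous c → (∀ t, c t ∈ X ×ˢ X) →
      IsInput U fun t => h (c t).1 := fun hc hcX =>
    .of_continuous (hh.comp_continuous hc.fst fun t => (hcX t).1) fun t _ => hhU (hcX t).1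
  have hin2 : ∀ {c : ℝ → E × E}, Continuous c → (∀ t, c t ∈ X ×ˢ X) →
      IsInput U fun t => h (c t).2 := fun hc hcX =>
    .of_continuous (hh.comp_continuous hc.snd fun t => (hcX t).2) fun t _ => hhU (hcX t).2
  have hlt : (t : EReal) < ((t + 1 : ℝ) : EReal) := by exact_mod_cast lt_add_one t
  constructor
  · exact hanti.monotone _ _ (hin2 hc hcX) (hin2 hvc hvX)
      (fun s _ => hanti.antitone _ (hvX s).2 _ (hcX s).2 ((hcA s).2 _ (hvW s)).2)
      τ _ _ _ hx hv1 (h0.2 _ (hvW 0)).1 t ht htτ hlt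
  · exact hanti.monotone _ _ (hin1 hvc hvX) (hin1 hc hcX)
      (fun s _ => hanti.antitone _ (hcX s).1 _ (hvX s).1 ((hcA s).2 _ (hvW s)).1)
      _ τ _ _ hv2 hz (h0.2 _ (hvW 0)).2 t ht hlt htτ

/-- The points above a backward invariant set form an invariant set. -/
theorem IsBackwardInvariant.loopInvariant_upper {W : Set (E × E)}
    (hW : IsBackwardInvariant f h X W) (hWX : W ⊆ X ×ˢ X) (hh : ContinuousOn h X)
    (hhU : MapsTo h X U) (hanti : IsIOAntiMonotone f h X U K L) :
    LoopInvariant f h X (X ×ˢ X ∩ {q | ∀ w ∈ W, mixedLE K w q}) := by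
  intro c hc hcA τ x z hx hz h0 t ht htτ
  -- Swapping the components exchanges the two equations and reverses the mixed order, which reduces
  -- the claim to lower sets.
  have hsw : IsBackwardInvariant f h X (Prod.swap '' W) := by
    rintro _ ⟨w, hw, rfl⟩ T hT
    obtain ⟨v, hvc, hvW, hvT, hv1, hv2⟩ := hW w hw T hT
    exact ⟨fun t => (v t).swap, continuous_swap.comp hvc, fun t => ⟨_, hvW t, rfl⟩, congrArg Prod.swap hvT,
      hv2, hv1⟩
  have key : ∀ q : E × E, q ∈ X ×ˢ X ∩ {q | ∀ w ∈ W, mixedLE K w q} ↔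
      q.swap ∈ X ×ˢ X ∩ {q | ∀ w ∈ Prod.swap '' W, mixedLE K q w} := by
    intro q
    refine and_congr ⟨And.symm, And.symm⟩ ⟨?_, fun hq w hw => (hq _ ⟨w, hw, rfl⟩).symm⟩
    rintro hq _ ⟨w, hw, rfl⟩
    exact (hq w hw).symm
  rw [key]
  refine hsw.loopInvariant_lower ?_ hh hhU hanti (fun t => (c t).swap) (continuous_swap.comp hc)
    (fun t => (key _).1 (hcA t)) τ z x hz hx ((key _).1 h0) t ht htτ
  rintro _ ⟨w, hw, rfl⟩
  exact (hWX hw).symm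

/-- Below each limit set there is another one. -/
theorem exists_isBackwardInvariant_below [ProperSpace E] (hX : IsClosed X)
    (hXrect : ∀ S ⊆ X, Bornology.IsBounded S →
      ∃ a ∈ X, ∃ b ∈ X, ∀ s ∈ S, coneLE K a s ∧ coneLE K s b)
    (hf : ContinuousOn (Function.uncurry f) (X ×ˢ U)) (hwp : IsWellPosed f X U)
    (hh : ContinuousOn h X) (hhU : MapsTo h X U) (hanti : IsIOAntiMonotone f h X U K L)
    (hB : ∀ (τ : EReal) (x z : ℝ → E), IsExtendedSolution f h X τ x z →
      Bornology.IsBounded ((fun t => (x t, z t)) '' {t : ℝ | 0 ≤ t ∧ (t : EReal) < τ}))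
    {W : Set (E × E)} (hW : IsBackwardInvariant f h X W) (hWX : W ⊆ X ×ˢ X)
    (hWb : Bornology.IsBounded W) :
    ∃ W' ⊆ X ×ˢ X, W'.Nonempty ∧ Bornology.IsBounded W' ∧ IsBackwardInvariant f h X W' ∧
      ∀ p ∈ W', ∀ w ∈ W, mixedLE K p w := by
  -- An interval around both projections of `W` has a corner `(a, b)` below `W` in the mixed order.
  -- A solution from there stays below `W`, and its limit set is the required one.
  obtain ⟨a, ha, b, hb, hab⟩ := hXrect (Prod.fst '' W ∪ Prod.snd '' W) (by
    rintro _ (⟨w, hw, rfl⟩ | ⟨w, hw, rfl⟩)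
    exacts [(hWX hw).1, (hWX hw).2]) (hWb.image_fst.union hWb.image_snd)
  have hAc : IsClosed (X ×ˢ X ∩ {q | ∀ w ∈ W, mixedLE K q w}) :=
    (hX.prod hX).inter (isClosed_setOf_forall_mixedLE K W)
  have hAX : X ×ˢ X ∩ {q | ∀ w ∈ W, mixedLE K q w} ⊆ X ×ˢ X := inter_subset_left
  have hq : (a, b) ∈ X ×ˢ X ∩ {q | ∀ w ∈ W, mixedLE K q w} :=
    ⟨⟨ha, hb⟩, fun w hw => ⟨(hab _ (.inl ⟨w, hw, rfl⟩)).1, (hab _ (.inr ⟨w, hw, rfl⟩)).2⟩⟩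
  obtain ⟨y, hy, -⟩ := exists_isSolution_extendedField_global hX hf hwp hh hhU hAc hAX
    (hW.loopInvariant_lower hWX hh hhU hanti) hB hq
  have hyA : ∀ t, 0 ≤ t → y t ∈ X ×ˢ X ∩ {q | ∀ w ∈ W, mixedLE K q w} := fun t ht =>
    hy.mem t ht (EReal.coe_lt_top t)
  have hyb : Bornology.IsBounded (y '' Ici 0) := by
    simpa [Ici] using hB _ _ _ (hy.isExtendedSolution hAX)
  have hyX : IsSolution (extendedField f h) (X ×ˢ X) (fun _ => ()) ⊤ y :=
    ⟨hy.pos, fun t ht htτ => hAX (hy.mem t ht htτ), hy.integrable, hy.eq_integral⟩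
  have hev : ∀ {S : Set (E × E)}, (∀ t, 0 ≤ t → y t ∈ S) → ∀ᶠ t in atTop, y t ∈ S := fun hS =>
    (eventually_ge_atTop 0).mono hS
  have hsub : {w | MapClusterPt w atTop y} ⊆ X ×ˢ X ∩ {q | ∀ w ∈ W, mixedLE K q w} := fun w hw =>
    hAc.mem_of_mapClusterPt hw (hev hyA)
  refine ⟨{w | MapClusterPt w atTop y}, hsub.trans hAX, ?_, ?_,
    isBackwardInvariant_setOf_mapClusterPt hX hf hh hhU hyX hyb, fun p hp => (hsub hp).2⟩
  · obtain ⟨w, -, hw⟩ := hyb.isCompact_closure.exists_mapClusterPt (f := atTop) (u := y)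
      (le_principal_iff.2 (hev fun t ht => subset_closure ⟨t, ht, rfl⟩))
    exact ⟨w, hw⟩
  · refine hyb.closure.subset fun w hw => ?_
    exact isClosed_closure.mem_of_mapClusterPt hw (hev fun t ht => subset_closure ⟨t, ht, rfl⟩)

end LimitSets

/-! ### Steady states in compact convex invariant sets. -/

section SteadyState

theorem IsSolution.hasDerivWithinAt_zero {E F : Type*} [NormedAddCommGroup E] [NormedSpace ℝ E]
    [CompleteSpace E] [TopologicalSpace F] {f : E → F → E} {X : Set E} {U : Set F} {v : F}
    {τ : EReal} {x : ℝ → E} (hf : ContinuousOn (Function.uncurry f) (X ×ˢ U)) (hv : v ∈ U)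
    (hx : IsSolution f X (fun _ => v) τ x) : HasDerivWithinAt x (f (x 0) v) (Ici 0) 0 := by
  obtain ⟨T, hT0, hTτ⟩ := EReal.lt_iff_exists_real_btwn.1 hx.pos
  have hT : 0 < T := by exact_mod_cast hT0
  have hlt : ∀ t ≤ T, (t : EReal) < τ := fun t ht => (EReal.coe_le_coe_iff.2 ht).trans_lt hTτ
  have hc : ContinuousOn (fun s => f (x s) v) (Icc 0 T) :=
    hf.comp ((hx.continuousOn_Icc hT.le hTτ).prodMk continuousOn_const)
      fun t ht => ⟨hx.mem t ht.1 (hlt t ht.2), hv⟩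
  have h1 : HasDerivWithinAt (fun t => ∫ s in (0 : ℝ)..t, f (x s) v) (f (x 0) v) (Ici 0) 0 := by
    refine intervalIntegral.integral_hasDerivWithinAt_right (t := Ioi 0)
      (IntervalIntegrable.refl) ?_ ?_
    · rw [← nhdsWithin_Ioo_eq_nhdsGT hT]
      exact (hc.mono Ioo_subset_Icc_self).stronglyMeasurableAtFilter_nhdsWithin measurableSet_Ioo 0
    · have h2 := (hc 0 ⟨le_rfl, hT.le⟩).mono (Ioo_subset_Icc_self)
      rwa [ContinuousWithinAt, nhdsWithin_Ioo_eq_nhdsGT hT] at h2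
  refine (h1.const_add (x 0)).congr_of_eventuallyEq ?_ (by simp)
  filter_upwards [Icc_mem_nhdsGE hT] with t ht
  exact hx.eq_integral t ht.1 (hlt t ht.2)

theorem nonpos_of_hasDerivWithinAt_of_eventually_nonpos {g : ℝ → ℝ} {d : ℝ}
    (hg : HasDerivWithinAt g d (Ici 0) 0) (h0 : g 0 = 0) (hle : ∀ᶠ t in 𝓝[>] 0, g t ≤ 0) :
    d ≤ 0 := by
  have h1 := (hasDerivWithinAt_iff_tendsto_slope' (by simp)).1 (hg.mono Ioi_subset_Ici_self)
  refine le_of_tendsto h1 ?_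
  filter_upwards [hle, self_mem_nhdsWithin] with t ht ht0
  rw [slope_def_field, h0, sub_zero, sub_zero]
  exact div_nonpos_of_nonpos_of_nonneg ht (le_of_lt ht0)

/-- A compact convex invariant set contains a steady state. -/
theorem LoopInvariant.exists_isExtendedSteadyState {E F : Type*} [NormedAddCommGroup E]
    [InnerProductSpace ℝ E] [FiniteDimensional ℝ E] [NormedAddCommGroup F] [MeasurableSpace F]
    [BorelSpace F] {f : E → F → E} {h : E → F} {X : Set E} {U : Set F}
    (hf : ContinuousOn (Function.uncurry f) (X ×ˢ U)) (hwp : IsWellPosed f X U)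
    (hh : ContinuousOn h X) (hhU : MapsTo h X U) {D : Set (E × E)} (hD : LoopInvariant f h X D)
    (hDX : D ⊆ X ×ˢ X) (hDc : IsCompact D) (hDconv : Convex ℝ D) (hDne : D.Nonempty) :
    ∃ e ∈ D, IsExtendedSteadyState f h X e := by
  -- The product with its Euclidean norm supplies the inner product for the variational inequality.
  let ι := WithLp.prodContinuousLinearEquiv 2 ℝ E E
  have hG : ContinuousOn (fun w => ι.symm (extendedField f h (ι w) ())) (ι.symm '' D) := by
    refine ι.symm.continuous.comp_continuousOn (((continuousOn_extendedField hf hh hhU).mono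
      hDX).comp ι.continuous.continuousOn ?_)
    rintro _ ⟨p, hp, rfl⟩
    simpa using hp
  obtain ⟨_, ⟨q, hq, rfl⟩, hvar⟩ := exists_forall_inner_sub_nonpos
    (hDc.image ι.symm.continuous) (hDconv.linear_image ι.symm.toLinearEquiv.toLinearMap)
    (hDne.image _) hG
  have hvar' : ∀ p ∈ D, inner ℝ (f q.1 (h q.2)) (p.1 - q.1) +
      inner ℝ (f q.2 (h q.1)) (p.2 - q.2) ≤ 0 := by
    intro p hp
    have h1 := hvar _ ⟨p, hp, rfl⟩
    rw [WithLp.prod_inner_apply] at h1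
    exact h1
  have hqX := hDX hq
  have h2U : h q.2 ∈ U := hhU hqX.2
  have h1U : h q.1 ∈ U := hhU hqX.1
  -- With inputs frozen at `q`, the responses stay in `D`, so the inner product of the field at `q`
  -- with their displacement is nonpositive. It vanishes at time zero with right derivative the
  -- squared norm of the field, which must therefore be zero.
  obtain ⟨τ₁, x, hx, hx0⟩ := hwp.exists_solution _
    (IsInput.of_continuous continuous_const fun _ _ => h2U) q.1 hqX.1
  obtain ⟨τ₂, z, hz, hz0⟩ := hwp.exists_solution _
    (IsInput.of_continuous continuous_const fun _ _ => h1U) q.2 hqX.2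
  obtain ⟨T, hT0, hTτ⟩ := EReal.lt_iff_exists_real_btwn.1 (lt_min hx.pos hz.pos)
  have hT : 0 < T := by exact_mod_cast hT0
  have hstay : ∀ t, 0 ≤ t → t < T → (x t, z t) ∈ D := fun t ht htT =>
    hD (fun _ => q) continuous_const (fun _ => hq) T x z
      (hx.mono hT0 (hTτ.le.trans (min_le_left _ _)))
      (hz.mono hT0 (hTτ.le.trans (min_le_right _ _))) (by rw [hx0, hz0]; exact hq) t ht
      (by exact_mod_cast htT)
  have hdx := hx.hasDerivWithinAt_zero hf h2U
  have hdz := hz.hasDerivWithinAt_zero hf h1U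
  rw [hx0] at hdx
  rw [hz0] at hdz
  have hd := ((hasDerivWithinAt_const (0 : ℝ) (Ici 0) (f q.1 (h q.2))).inner ℝ
    (hdx.sub_const q.1)).add ((hasDerivWithinAt_const (0 : ℝ) (Ici 0) (f q.2 (h q.1))).inner ℝ
    (hdz.sub_const q.2))
  have hle := nonpos_of_hasDerivWithinAt_of_eventually_nonpos hd (by simp [hx0, hz0]) (by
    filter_upwards [Ioo_mem_nhdsGT hT] with t ht
    exact hvar' _ (hstay t ht.1.le ht.2))
  simp only [inner_zero_left, add_zero, real_inner_self_eq_norm_sq] at hle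
  refine ⟨q, hq, hqX.1, hqX.2, ?_, ?_⟩
  · rw [← norm_eq_zero]
    exact pow_eq_zero_iff two_ne_zero |>.1
      (le_antisymm (by nlinarith [sq_nonneg ‖f q.2 (h q.1)‖]) (sq_nonneg _))
  · rw [← norm_eq_zero]
    exact pow_eq_zero_iff two_ne_zero |>.1
      (le_antisymm (by nlinarith [sq_nonneg ‖f q.1 (h q.2)‖]) (sq_nonneg _))

end SteadyState

/-! ### Feedback solutions as diagonal solutions. -/

section Feedback

variable {E F : Type*} [NormedAddCommGroup E] [NormedSpace ℝ E]
  [NormedAddCommGroup F] [MeasurableSpace F] [BorelSpace F]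
  {f : E → F → E} {h : E → F} {X : Set E} {U : Set F}

/-- A diagonal curve feeds the same input to both components, so open-loop uniqueness keeps them
equal. This lets a feedback solution be continued within the extended loop. -/
theorem loopInvariant_diagonal (hwp : IsWellPosed f X U) (hh : ContinuousOn h X)
    (hhU : MapsTo h X U) : LoopInvariant f h X (X ×ˢ X ∩ {p | p.1 = p.2}) := by
  intro c hc hcA τ x z hx hz h0 t ht htτ
  refine ⟨⟨hx.mem t ht htτ, hz.mem t ht htτ⟩, ?_⟩
  refine hwp.unique _ (IsInput.of_continuous (hh.comp_continuous hc.snd fun t => (hcA t).1.2)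
    fun t _ => hhU (hcA t).1.2) τ x z hx (hz.congr (fun _ _ _ => rfl) fun s _ _ => ?_) h0.2 t ht htτ
  exact congrArg h (hcA s).2.symm

/-- Bounded maximal solutions of the feedback system are global. -/
theorem IsMaximalFeedbackSolution.eq_top [ProperSpace E] (hX : IsClosed X)
    (hf : ContinuousOn (Function.uncurry f) (X ×ˢ U)) (hwp : IsWellPosed f X U)
    (hh : ContinuousOn h X) (hhU : MapsTo h X U) {τ : EReal} {x : ℝ → E}
    (hx : IsMaximalFeedbackSolution f h X τ x)
    (hb : Bornology.IsBounded ((fun t => (x t, x t)) '' {t : ℝ | 0 ≤ t ∧ (t : EReal) < τ})) :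
    τ = ⊤ := by
  obtain ⟨hx, hmax⟩ := hx
  by_contra hτ
  lift τ to ℝ using ⟨hτ, (EReal.bot_lt_zero.trans hx.pos).ne'⟩
  have hτ0 : 0 < τ := by exact_mod_cast hx.pos
  have hAc : IsClosed (X ×ˢ X ∩ {p : E × E | p.1 = p.2}) :=
    (hX.prod hX).inter (isClosed_eq continuous_fst continuous_snd)
  have hy := IsExtendedSolution.isSolution (A := X ×ˢ X ∩ {p : E × E | p.1 = p.2}) ⟨hx, hx⟩
    fun t ht htτ => ⟨⟨hx.mem t ht htτ, hx.mem t ht htτ⟩, rfl⟩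
  obtain ⟨M, -, hM⟩ := exists_bound_extendedField hX hf hh hhU hb (by
    rintro _ ⟨t, ⟨ht, htτ⟩, rfl⟩
    exact ⟨hx.mem t ht htτ, hx.mem t ht htτ⟩)
  obtain ⟨σ, hσ, w, hw, hwx⟩ := hy.extend hAc (M := M)
    (fun t ht htτ => hM _ ⟨t, ⟨ht, by exact_mod_cast htτ⟩, rfl⟩)
    fun p hp => exists_isSolution_extendedField_local hX hf hwp hh hhU hAc inter_subset_left
      (loopInvariant_diagonal hwp hh hhU) hp
  have hfb : IsFeedbackSolution f h X ((τ + σ : ℝ) : EReal) fun t => (w t).1 :=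
    (hw.isExtendedSolution inter_subset_left).1.congr (fun _ _ _ => rfl)
      fun t ht htτ => congrArg h (hw.mem t ht htτ).2
  have := hmax _ _ hfb (by exact_mod_cast by linarith) fun t ht htτ =>
    congrArg Prod.fst (hwx t ht (by exact_mod_cast htτ))
  norm_cast at this
  linarith

end Feedback

/-! ### Global existence and convergence. -/

theorem mainTheorem1 (n m : ℕ)
    (X : Set (EuclideanSpace ℝ (Fin n))) (U : Set (EuclideanSpace ℝ (Fin m)))
    (hXclosed : IsClosed X) (hXconvex : Convex ℝ X)
    (hUclosed : IsClosed U) (hUconvex : Convex ℝ U)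
    (K : ProperCone ℝ (EuclideanSpace ℝ (Fin n))) (L : ProperCone ℝ (EuclideanSpace ℝ (Fin m)))
    (hKpointed : ∀ v ∈ K, -v ∈ K → v = 0)
    (hKinterior : (interior (K : Set (EuclideanSpace ℝ (Fin n)))).Nonempty)
    (hLpointed : ∀ v ∈ L, -v ∈ L → v = 0)
    (hLinterior : (interior (L : Set (EuclideanSpace ℝ (Fin m)))).Nonempty)
    -- every bounded subset of `X` is contained in an order interval with end points in `X`
    (hXrect : ∀ S ⊆ X, Bornology.IsBounded S →
      ∃ a ∈ X, ∃ b ∈ X, ∀ s ∈ S, coneLE K a s ∧ coneLE K s b)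
    (f : EuclideanSpace ℝ (Fin n) → EuclideanSpace ℝ (Fin m) → EuclideanSpace ℝ (Fin n))
    (h : EuclideanSpace ℝ (Fin n) → EuclideanSpace ℝ (Fin m))
    (hf : ContinuousOn (Function.uncurry f) (X ×ˢ U))
    (hwp : IsWellPosed f X U)
    (hh : ContinuousOn h X) (hhU : MapsTo h X U)
    (hanti : IsIOAntiMonotone f h X U K L)
    -- every solution of the extended closed loop is bounded
    (hB : ∀ (τ : EReal) (x z : ℝ → EuclideanSpace ℝ (Fin n)), IsExtendedSolution f h X τ x z →
      Bornology.IsBounded ((fun t => (x t, z t)) '' {t : ℝ | 0 ≤ t ∧ (t : EReal) < τ}))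
    (hunique : ∃! p : EuclideanSpace ℝ (Fin n) × EuclideanSpace ℝ (Fin n),
      IsExtendedSteadyState f h X p) :
    ∃ xbar ∈ X, ∀ (τ : EReal) (x : ℝ → EuclideanSpace ℝ (Fin n)),
      IsMaximalFeedbackSolution f h X τ x → τ = ⊤ ∧ Tendsto x atTop (𝓝 xbar) := by
  obtain ⟨e, he, heu⟩ := hunique
  -- The swap of a steady state is a steady state, so uniqueness places `e` on the diagonal.
  have hswap : e.swap = e := heu _ ⟨he.2.1, he.1, he.2.2.2, he.2.2.1⟩
  have he12 : e.2 = e.1 := congrArg Prod.fst hswap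
  refine ⟨e.1, he.1, fun τ x hx => ?_⟩
  obtain rfl := hx.eq_top hXclosed hf hwp hh hhU (hB _ _ _ ⟨hx.1, hx.1⟩)
  refine ⟨rfl, ?_⟩
  have hxX : ∀ t, 0 ≤ t → x t ∈ X := fun t ht => hx.1.mem t ht (EReal.coe_lt_top t)
  set y : ℝ → EuclideanSpace ℝ (Fin n) × EuclideanSpace ℝ (Fin n) := fun t => (x t, x t) with hy_def
  have hy : IsSolution (extendedField f h) (X ×ˢ X) (fun _ => ()) ⊤ y :=
    IsExtendedSolution.isSolution ⟨hx.1, hx.1⟩ fun t ht _ => ⟨hxX t ht, hxX t ht⟩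
  have hyb : Bornology.IsBounded (y '' Ici 0) := by
    simpa [Ici] using hB _ _ _ ⟨hx.1, hx.1⟩
  have hdiag : ∀ w, MapClusterPt w atTop y → w ∈ X ×ˢ X ∩ {p | p.1 = p.2} := fun w hw =>
    ((hXclosed.prod hXclosed).inter
      (isClosed_eq continuous_fst continuous_snd)).mem_of_mapClusterPt hw
      ((eventually_ge_atTop 0).mono fun t ht => ⟨⟨hxX t ht, hxX t ht⟩, rfl⟩)
  have hycl : ∀ᶠ t in atTop, y t ∈ closure (y '' Ici 0) :=
    (eventually_ge_atTop 0).mono fun t ht => subset_closure ⟨t, ht, rfl⟩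
  have hlim : Tendsto y atTop (𝓝 e) := by
    refine hyb.isCompact_closure.tendsto_nhds_of_unique_mapClusterPt hycl fun w _ hw => ?_
    set W₁ := {w | MapClusterPt w atTop y}
    have hW₁X : W₁ ⊆ X ×ˢ X := fun w hw => (hdiag w hw).1
    have hW₁b : Bornology.IsBounded W₁ := hyb.closure.subset fun w hw =>
      isClosed_closure.mem_of_mapClusterPt hw hycl
    have hW₁ := isBackwardInvariant_setOf_mapClusterPt hXclosed hf hh hhU hy hyb
    obtain ⟨W₂, hW₂X, hW₂ne, hW₂b, hW₂, h21⟩ := exists_isBackwardInvariant_below hXclosed hXrect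
      hf hwp hh hhU hanti hB hW₁ hW₁X hW₁b
    obtain ⟨W₃, hW₃X, ⟨w₃, hw₃⟩, -, hW₃, h32⟩ := exists_isBackwardInvariant_below hXclosed hXrect
      hf hwp hh hhU hanti hB hW₂ hW₂X hW₂b
    set D := (X ×ˢ X ∩ {q | ∀ w ∈ W₁, mixedLE K q w}) ∩ (X ×ˢ X ∩ {q | ∀ w ∈ W₃, mixedLE K w q})
    have hDinv : LoopInvariant f h X D := (hW₁.loopInvariant_lower hW₁X hh hhU hanti).inter
      (hW₃.loopInvariant_upper hW₃X hh hhU hanti)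
    have hXX := hXclosed.prod hXclosed
    have hDcl : IsClosed D := (hXX.inter (isClosed_setOf_forall_mixedLE K W₁)).inter
      (hXX.inter (isClosed_setOf_forall_mixedLE' K W₃))
    have hXXc := hXconvex.prod hXconvex
    have hDconv : Convex ℝ D := (hXXc.inter (convex_setOf_forall_mixedLE K W₁)).inter
      (hXXc.inter (convex_setOf_forall_mixedLE' K W₃))
    -- A single point of `W₃` and a single point of `W₁` already confine `D` to a bounded
    -- mixed-order interval.
    have hDb : Bornology.IsBounded D := (isBounded_setOf_mixedLE hKpointed w₃ w).subset
      fun q hq => ⟨hq.2.2 w₃ hw₃, hq.1.2 w hw⟩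
    have hDne : D.Nonempty := hW₂ne.mono fun p hp =>
      ⟨⟨hW₂X hp, h21 p hp⟩, hW₂X hp, fun q hq => h32 q hq p hp⟩
    obtain ⟨e', he'D, he'⟩ := hDinv.exists_isExtendedSteadyState hf hwp hh hhU
      (fun q hq => hq.1.1) (Metric.isCompact_of_isClosed_isBounded hDcl hDb) hDconv hDne
    obtain rfl := heu e' he'
    have hle := he'D.1.2 w hw
    have hw12 : w.1 = w.2 := (hdiag w hw).2
    -- Both points are diagonal, so the second component of the mixed inequality reverses the first.
    have h1 : w.1 - e'.1 = 0 := by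
      refine hKpointed _ hle.1 ?_
      have := hle.2
      rw [coneLE, he12, ← hw12] at this
      rwa [neg_sub]
    have h2 : w.1 = e'.1 := sub_eq_zero.1 h1
    exact Prod.ext h2 (by rw [← hw12, h2, he12])
  exact (continuous_fst.tendsto e).comp hlim
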